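/- Let $K$ be a non-trivially valued algebraically closed field (a model of ACVF), of any characteristic and any residue characteristic, with surjective valuation $v:K\to\Gamma_\infty=\Gamma\cup\{\infty\}$. Definable means definable with parameters in the two-sorted language with sorts $K$ (with the language of rings) and $\Gamma_\infty$ (with the language of ordered groups and a constant for $\infty$) and with the function $v$. (1) Let $\kappa$ be an uncountable cardinal such that $(K,v)$ is $\kappa$-saturated, and let $X$ be a subgroup of $(K,+)$ which is type-definable, that is, $X$ is an intersection of fewer than $\kappa$ definable subsets of $K$. Then $X$ is an intersection of fewer than $\kappa$ definable subgroups of $(K,+)$. (2) Every definable subgroup $H$ of $(K,+)$ is equal to $K$, or is finite, or is a finite extension of a ball around $0$; the last means that for some $r\in\Gamma$ the group $H$ contains $B_r=\{x\in K\mid v(x)\ge r\}$ or $B_r^-=\{x\in K\mid v(x)>r\}$ as a subgroup of finite index. (In (2) no saturation is assumed.) -/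

import Mathlib

universe u

namespace ACVF

/-! ### The two-sorted language of valued fields

The two sorts are the field `K` and `Γ` (the value group together with `∞`, written `⊤`), with the
language of rings on `K`, the language of ordered groups with a constant for `∞` on `Γ`, and the
valuation. Terms and formulas have `n` free variables of the field sort, `m` free variables of the
value group sort, and parameters from the sets `A` and `C`. -/

/-- Terms of the field sort. -/
inductive FieldTerm {K : Type u} (A : Set K) (n : ℕ) : Type u
  | var (i : Fin n) : FieldTerm A n
  | param (a : A) : FieldTerm A n
  | zero : FieldTerm A n
  | one : FieldTerm A n
  | neg (s : FieldTerm A n) : FieldTerm A n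
  | add (s t : FieldTerm A n) : FieldTerm A n
  | mul (s t : FieldTerm A n) : FieldTerm A n

/-- Terms of the value group sort. -/
inductive ValueTerm {K Γ : Type u} (A : Set K) (C : Set Γ) (n m : ℕ) : Type u
  | var (i : Fin m) : ValueTerm A C n m
  | param (c : C) : ValueTerm A C n m
  | val (t : FieldTerm A n) : ValueTerm A C n m
  | infty : ValueTerm A C n m
  | zero : ValueTerm A C n m
  | neg (s : ValueTerm A C n m) : ValueTerm A C n m
  | add (s t : ValueTerm A C n m) : ValueTerm A C n m

/-- First-order formulas; `exField` and `exValue` bind the variable of index `0` of the respective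
sort. -/
inductive VFormula {K Γ : Type u} (A : Set K) (C : Set Γ) : ℕ → ℕ → Type u
  | eqField {n m : ℕ} (s t : FieldTerm A n) : VFormula A C n m
  | eqValue {n m : ℕ} (s t : ValueTerm A C n m) : VFormula A C n m
  | leValue {n m : ℕ} (s t : ValueTerm A C n m) : VFormula A C n m
  | not {n m : ℕ} (φ : VFormula A C n m) : VFormula A C n m
  | and {n m : ℕ} (φ ψ : VFormula A C n m) : VFormula A C n m
  | exField {n m : ℕ} (φ : VFormula A C (n + 1) m) : VFormula A C n m
  | exValue {n m : ℕ} (φ : VFormula A C n (m + 1)) : VFormula A C n m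

variable {K Γ : Type u} [Field K] [LinearOrderedAddCommGroupWithTop Γ]

/-- The value of a field term. -/
def FieldTerm.realize {A : Set K} {n : ℕ} (x : Fin n → K) : FieldTerm A n → K
  | .var i => x i
  | .param a => a
  | .zero => 0
  | .one => 1
  | .neg s => -s.realize x
  | .add s t => s.realize x + t.realize x
  | .mul s t => s.realize x * t.realize x

/-- The value of a value group term (with the convention `-∞ = ∞`). -/
def ValueTerm.realize (v : AddValuation K Γ) {A : Set K} {C : Set Γ} {n m : ℕ}
    (x : Fin n → K) (y : Fin m → Γ) : ValueTerm A C n m → Γ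
  | .var i => y i
  | .param c => c
  | .val t => v (t.realize x)
  | .infty => ⊤
  | .zero => 0
  | .neg s => -s.realize v x y
  | .add s t => s.realize v x y + t.realize v x y

/-- Satisfaction of a formula in the valued field `(K, v)`. -/
def VFormula.Realize (v : AddValuation K Γ) {A : Set K} {C : Set Γ} :
    {n m : ℕ} → VFormula A C n m → (Fin n → K) → (Fin m → Γ) → Prop
  | _, _, .eqField s t, x, _ => s.realize x = t.realize x
  | _, _, .eqValue s t, x, y => s.realize v x y = t.realize v x y
  | _, _, .leValue s t, x, y => s.realize v x y ≤ t.realize v x y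
  | _, _, .not φ, x, y => ¬ φ.Realize v x y
  | _, _, .and φ ψ, x, y => φ.Realize v x y ∧ ψ.Realize v x y
  | _, _, .exField φ, x, y => ∃ a : K, φ.Realize v (Fin.cons a x) y
  | _, _, .exValue φ, x, y => ∃ c : Γ, φ.Realize v x (Fin.cons c y)

/-- A subset of `Kⁿ × Γᵐ` is definable over `(A, C)` if it is defined by a formula with parameters
from `A` and `C`. -/
def DefinableOver (v : AddValuation K Γ) (A : Set K) (C : Set Γ) {n m : ℕ}
    (S : Set ((Fin n → K) × (Fin m → Γ))) : Prop :=
  ∃ φ : VFormula A C n m, S = {p | φ.Realize v p.1 p.2}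

/-- A subset of `K` is definable if it is defined by a formula with parameters. -/
def Definable (v : AddValuation K Γ) (X : Set K) : Prop :=
  DefinableOver v Set.univ Set.univ {p : (Fin 1 → K) × (Fin 0 → Γ) | p.1 0 ∈ X}

/-- A subset of `K` is type-definable (with respect to `κ`) if it is the intersection of fewer than
`κ` definable sets. -/
def TypeDefinable (v : AddValuation K Γ) (κ : Cardinal.{u}) (X : Set K) : Prop :=
  ∃ 𝒟 : Set (Set K), Cardinal.mk 𝒟 < κ ∧ (∀ D ∈ 𝒟, Definable v D) ∧ X = ⋂₀ 𝒟

/-- `(K, v)` is `κ`-saturated: every finitely satisfiable set of formulas, in finitely many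
variables of the two sorts and over fewer than `κ` parameters, is satisfiable in `(K, v)`. -/
def IsSaturated (v : AddValuation K Γ) (κ : Cardinal.{u}) : Prop :=
  ∀ (A : Set K) (C : Set Γ), Cardinal.mk A < κ → Cardinal.mk C < κ →
    ∀ (n m : ℕ) (𝒮 : Set (Set ((Fin n → K) × (Fin m → Γ)))),
      (∀ S ∈ 𝒮, DefinableOver v A C S) →
      (∀ 𝒯 : Set (Set ((Fin n → K) × (Fin m → Γ))), 𝒯 ⊆ 𝒮 → 𝒯.Finite → (⋂₀ 𝒯).Nonempty) →
      (⋂₀ 𝒮).Nonempty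

/-- The closed ball `{x | v x ≥ r}` around `0`. -/
def closedBall (v : AddValuation K Γ) (r : Γ) : Set K := {x | r ≤ v x}

/-- The open ball `{x | v x > r}` around `0`. -/
def openBall (v : AddValuation K Γ) (r : Γ) : Set K := {x | r < v x}

end ACVF

/-! Everything rests on one property of a nonempty definable `X ⊆ K`, called `HasWidth`: there is a
ball `W` around `0` (possibly `{0}` or `K`) such that finitely many cosets of `W` cover `X` and
every `w ∈ W` is a difference of two elements of `X`. If `X = H` is a subgroup, the second condition
gives `W ≤ H` and the first gives finite index; the shape of `W` decides between the three cases of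
(2). For (1), let `X` be a type-definable subgroup contained in a definable set `D` of the defining
family. Compactness gives a definable `E ⊇ X` with `E + E - E ⊆ D`. Let `W` be the ball attached to
`E`. Then `X + W` is a finite union of cosets of `W`, hence definable, and `x + w = x + (y + w) - y`
with `y, y + w ∈ E` shows `X + W ⊆ D`. One such group for each `D` suffices.

Width comes from the Swiss cheese description of definable sets. A finite Boolean combination of
balls has width because the residue field is infinite and balls around `0` form a chain, and width
passes to finite unions. In a countably saturated field, a back-and-forth with pairs of embeddings
of countable fields (`VFormula.realize_iff`) shows that a definable set depends only on the balls,
centred in and with radii from a countable algebraically closed subfield, that contain a point; two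
uses of saturation leave finitely many balls. The back-and-forth extends pairs of embeddings
algebraically by conjugacy of valuations in Galois extensions, and transcendentally by factoring
polynomials into linear factors. Without saturation, one passes to an ultrapower over `ℕ`, which is
countably saturated, and pulls the ball and the cosets back to a single coordinate. -/

namespace ACVF

open Polynomial

/-! ### Conjugacy of valuation rings in Galois extensions. -/

section Conjugacy

theorem mem_nonunits_iff_inv_notMem {L : Type*} [Field L] (V : ValuationSubring L) (x : L) :
    x ∈ V.nonunits ↔ x = 0 ∨ x⁻¹ ∉ V := by
  rw [ValuationSubring.mem_nonunits_iff, ← V.valuation_le_one_iff, map_inv₀, not_le]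
  by_cases hx : x = 0
  · simp [hx]
  · rw [one_lt_inv₀ (zero_lt_iff.2 ((_root_.map_ne_zero _).2 hx))]
    simp [hx]

section

variable {L Γ : Type*} [Field L] [LinearOrderedAddCommGroupWithTop Γ]

/-- The valuation ring of an additive valuation. -/
def addValuationSubring (w : AddValuation L Γ) : ValuationSubring L where
  carrier := {x | 0 ≤ w x}
  zero_mem' := by simp
  one_mem' := by simp
  add_mem' ha hb := w.map_le_add ha hb
  mul_mem' ha hb := by
    rw [Set.mem_ofPred_eq, w.map_mul]
    exact add_nonneg ha hb
  neg_mem' ha := by rwa [Set.mem_ofPred_eq, w.map_neg]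
  mem_or_inv_mem' x := by
    by_cases hx : x = 0
    · left; simp [hx]
    rcases le_total 0 (w x) with h | h
    · exact Or.inl h
    · right
      have h1 : w x + w x⁻¹ = 0 := by rw [← w.map_mul, mul_inv_cancel₀ hx, w.map_one]
      by_contra h2
      have h3 : w x + w x⁻¹ < 0 := by
        calc w x + w x⁻¹ ≤ 0 + w x⁻¹ := by gcongr
          _ = w x⁻¹ := zero_add _
          _ < 0 := not_le.1 h2
      exact h3.ne h1

theorem mem_addValuationSubring (w : AddValuation L Γ) (x : L) :
    x ∈ addValuationSubring w ↔ 0 ≤ w x := Iff.rfl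

theorem addValuation_le_iff (w : AddValuation L Γ) {x y : L} (hx : x ≠ 0) :
    w x ≤ w y ↔ y / x ∈ addValuationSubring w := by
  rw [mem_addValuationSubring, ← add_le_add_iff_left_of_ne_top (b := 0) (w.ne_top_iff.2 hx), zero_add,
    ← w.map_mul, div_mul_cancel₀ _ hx]

end

variable {F Ω : Type u} [Field F] [Field Ω] [Algebra F Ω]

/-- An element lying in every valuation ring above `A` is integral over `A`. -/
theorem mem_integralClosure_of_forall_valuationSubring (A : ValuationSubring F) (y : Ω)
    (h : ∀ V : ValuationSubring Ω, (∀ a ∈ A, algebraMap F Ω a ∈ V) → y ∈ V) :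
    y ∈ integralClosure A Ω := by
  have hC : IsIntegrallyClosedIn (integralClosure A Ω).toSubring Ω :=
    inferInstanceAs (IsIntegrallyClosedIn (integralClosure A Ω) Ω)
  by_contra hy
  obtain ⟨V, hV, hyV⟩ :=
    (integralClosure A Ω).toSubring.exists_le_valuationSubring_of_isIntegrallyClosedIn
      (x := y) hy
  exact hyV (h V fun a ha ↦ hV ((integralClosure A Ω).algebraMap_mem ⟨a, ha⟩))

/-- A nontrivial algebraic relation over `F` can be normalized with respect to a valuation ring:
the coefficients are in `A`, one of them is `1`, and the later ones are nonunits. -/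
theorem exists_normalized_relation (A : ValuationSubring F) {x : Ω} (hx : IsAlgebraic F x) :
    ∃ (n k : ℕ) (a : ℕ → F), k ≤ n ∧ (∀ i, a i ∈ A) ∧ a k = 1 ∧
      (∀ i, k < i → a i ∈ A.nonunits) ∧
      ∑ i ∈ Finset.range (n + 1), algebraMap F Ω (a i) * x ^ i = 0 := by
  obtain ⟨p, hp, hpx⟩ := hx
  obtain ⟨i₀, hi₀, hmax⟩ := p.support.exists_max_image (fun i ↦ A.valuation (p.coeff i))
    (Polynomial.support_nonempty.2 hp)
  have hmax' : ∀ i, A.valuation (p.coeff i) ≤ A.valuation (p.coeff i₀) := fun i ↦ by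
    by_cases hi : i ∈ p.support
    · exact hmax i hi
    · simp [notMem_support_iff.1 hi]
  -- The last index of maximal valuation is `k`. Division by its coefficient makes all coefficients
  -- integral and the later ones nonunits.
  let S := p.support.filter fun i ↦ A.valuation (p.coeff i) = A.valuation (p.coeff i₀)
  have hS : S.Nonempty := ⟨i₀, by simpa [S] using hi₀⟩
  set k := S.max' hS
  have hk : k ∈ S := S.max'_mem hS
  obtain ⟨hk1, hk2⟩ := Finset.mem_filter.1 hk
  have hk0 : p.coeff k ≠ 0 := mem_support_iff.1 hk1
  have hvk : A.valuation (p.coeff k) ≠ 0 := (_root_.map_ne_zero _).2 hk0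
  refine ⟨p.natDegree, k, fun i ↦ p.coeff i / p.coeff k, le_natDegree_of_ne_zero hk0,
    fun i ↦ ?_, div_self hk0, fun i hi ↦ ?_, ?_⟩
  · rw [← A.valuation_le_one_iff, map_div₀, hk2]
    exact div_le_one_of_le₀ (hmax' i) zero_le
  · rw [ValuationSubring.mem_nonunits_iff, map_div₀, div_lt_one₀ (zero_lt_iff.2 hvk)]
    refine lt_of_le_of_ne (hk2 ▸ hmax' i) fun h ↦ ?_
    have : i ∈ S := Finset.mem_filter.2 ⟨mem_support_iff.2 fun h0 ↦ ?_, h.trans hk2⟩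
    · exact absurd (S.le_max' i this) (not_le.2 hi)
    · rw [h0, map_zero] at h; exact hvk h.symm
  · rw [aeval_eq_sum_range] at hpx
    simp only [map_div₀, div_mul_eq_mul_div, ← Finset.sum_div, Algebra.smul_def] at hpx ⊢
    rw [hpx, zero_div]

/-- A valuation ring of an algebraic extension is a localization of the integral closure. -/
theorem exists_mem_integralClosure_mul_mem (A : ValuationSubring F) (O : ValuationSubring Ω)
    (hO : O.comap (algebraMap F Ω) = A) {x : Ω} (hx : IsAlgebraic F x) (hxO : x ∈ O) :
    ∃ y ∈ integralClosure A Ω, y * x ∈ integralClosure A Ω ∧ y ≠ 0 ∧ y⁻¹ ∈ O := by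
  obtain ⟨n, k, a, hkn, haA, hak, hnon, hrel⟩ := exists_normalized_relation A hx
  by_cases hx0 : x = 0
  · exact ⟨1, one_mem _, by simp [hx0], one_ne_zero, by simp⟩
  -- The top part of the relation divided by `x ^ k`. Thus `y` is a polynomial in `x`, while by the
  -- relation `y * x` is one in `x⁻¹`, both with coefficients in `A`. A valuation ring above `A`
  -- contains `x` or `x⁻¹`, and in either case it contains `y` and `y * x`.
  let y : Ω := ∑ i ∈ Finset.Ico k (n + 1), algebraMap F Ω (a i) * x ^ (i - k)
  have hyx : y * x = -∑ i ∈ Finset.range k, algebraMap F Ω (a i) * x⁻¹ ^ (k - 1 - i) := by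
    have h1 : y * x ^ k + ∑ i ∈ Finset.range k, algebraMap F Ω (a i) * x ^ i = 0 := by
      rw [← hrel, ← Finset.sum_range_add_sum_Ico _ (show k ≤ n + 1 by omega), add_comm]
      congr 1
      rw [Finset.sum_mul]
      refine Finset.sum_congr rfl fun i hi ↦ ?_
      rw [mul_assoc, ← pow_add, Nat.sub_add_cancel (Finset.mem_Ico.1 hi).1]
    rcases Nat.eq_zero_or_pos k with hk0 | hk0
    · rw [hk0] at h1 ⊢
      simp only [pow_zero, mul_one, Finset.range_zero, Finset.sum_empty, add_zero] at h1
      simp [h1]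
    · have h2 : y * x = (y * x ^ k) * x⁻¹ ^ (k - 1) := by
        obtain ⟨l, rfl⟩ : ∃ l, k = l + 1 := ⟨k - 1, by omega⟩
        simp only [Nat.add_sub_cancel, pow_succ, inv_pow]
        field_simp
      rw [h2, eq_neg_of_add_eq_zero_left h1, neg_mul, Finset.sum_mul]
      congr 1
      refine Finset.sum_congr rfl fun i hi ↦ ?_
      have hi' := Finset.mem_range.1 hi
      rw [mul_assoc, show k - 1 = i + (k - 1 - i) by omega, pow_add, ← mul_assoc (x ^ i),
        ← mul_pow, mul_inv_cancel₀ hx0, one_pow, one_mul]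
      congr 3
      omega
  have key : ∀ V : ValuationSubring Ω, (∀ b ∈ A, algebraMap F Ω b ∈ V) → y ∈ V ∧ y * x ∈ V := by
    intro V hV
    rcases V.mem_or_inv_mem x with h | h
    · have : y ∈ V := sum_mem fun i _ ↦ mul_mem (hV _ (haA i)) (pow_mem h _)
      exact ⟨this, mul_mem this h⟩
    · have : y * x ∈ V := by
        rw [hyx]
        exact neg_mem (sum_mem fun i _ ↦ mul_mem (hV _ (haA i)) (pow_mem h _))
      refine ⟨?_, this⟩
      have h2 := mul_mem this h
      rwa [mul_assoc, mul_inv_cancel₀ hx0, mul_one] at h2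
  have hAO : ∀ b ∈ A, algebraMap F Ω b ∈ O := fun b hb ↦ by
    rw [← hO] at hb; exact hb
  -- Modulo the maximal ideal of `O` only the term `a k = 1` of `y` survives.
  have hval : O.valuation y = 1 := by
    have hy : y = 1 + ∑ i ∈ Finset.Ico (k + 1) (n + 1), algebraMap F Ω (a i) * x ^ (i - k) := by
      rw [show y = _ from Finset.sum_eq_sum_Ico_succ_bot (by omega) _]
      simp [hak]
    rw [hy, Valuation.map_one_add_of_lt]
    refine Valuation.map_sum_lt _ one_ne_zero fun i hi ↦ ?_
    rw [map_mul]
    have hik : a i ∈ A.nonunits := hnon i (by have := Finset.mem_Ico.1 hi; omega)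
    refine mul_lt_one_of_lt_of_le ?_ ((O.valuation_le_one_iff _).2 (pow_mem hxO _))
    by_contra hge
    rw [not_lt] at hge
    have hinv : algebraMap F Ω (a i)⁻¹ ∈ O := by
      rw [← O.valuation_le_one_iff, map_inv₀, map_inv₀]
      exact inv_le_one_of_one_le₀ hge
    have : (a i)⁻¹ ∈ A := by rw [← hO]; exact hinv
    rw [← A.valuation_le_one_iff, map_inv₀] at this
    have hlt := (A.mem_nonunits_iff).1 hik
    by_cases hz : a i = 0
    · rw [hz, map_zero, map_zero] at hge
      exact absurd hge (by simp)
    · exact absurd this (not_le.2 ((one_lt_inv₀ (zero_lt_iff.2 ((_root_.map_ne_zero _).2 hz))).2 hlt))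
  refine ⟨y, mem_integralClosure_of_forall_valuationSubring A y fun V hV ↦ (key V hV).1,
    mem_integralClosure_of_forall_valuationSubring A _ fun V hV ↦ (key V hV).2, ?_, ?_⟩
  · rintro h
    rw [h, map_zero] at hval
    exact zero_ne_one hval
  · rw [← O.valuation_le_one_iff, map_inv₀, hval, inv_one]

theorem mem_of_mem_integralClosure (A : ValuationSubring F) (O : ValuationSubring Ω)
    (hO : O.comap (algebraMap F Ω) = A) {x : Ω} (hx : x ∈ integralClosure A Ω) : x ∈ O := by
  have hle : (integralClosure A Ω).toSubring ≤ O.toSubring := by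
    have : IsIntegrallyClosedIn O.toSubring Ω := inferInstanceAs (IsIntegrallyClosedIn O Ω)
    intro z hz
    obtain ⟨p, hp, hpz⟩ := hz
    have hf : ∀ a : A, algebraMap F Ω a ∈ O.toSubring := fun a ↦ by
      have h : (a : F) ∈ O.comap (algebraMap F Ω) := by rw [hO]; exact a.2
      exact h
    let f : A →+* O.toSubring := ((algebraMap F Ω).comp A.subtype).codRestrict O.toSubring hf
    have hint : IsIntegral O.toSubring z := by
      refine ⟨p.map f, hp.map f, ?_⟩
      rw [Polynomial.eval₂_map]
      exact hpz
    obtain ⟨w, hw⟩ := (IsIntegrallyClosedIn.isIntegral_iff (R := O.toSubring)).1 hint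
    rw [← hw]
    exact w.2
  exact hle hx

/-- The centre of a valuation ring on the integral closure. -/
noncomputable def centre (A : ValuationSubring F) (O : ValuationSubring Ω)
    (hO : O.comap (algebraMap F Ω) = A) : Ideal (integralClosure A Ω) :=
  (IsLocalRing.maximalIdeal O).comap
    ((integralClosure A Ω).subtype.codRestrict O.toSubring
      fun x ↦ mem_of_mem_integralClosure A O hO x.2)

theorem mem_centre (A : ValuationSubring F) (O : ValuationSubring Ω)
    (hO : O.comap (algebraMap F Ω) = A) (x : integralClosure A Ω) :
    x ∈ centre A O hO ↔ (x : Ω) ∈ O.nonunits := by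
  rw [centre, Ideal.mem_comap, ValuationSubring.valuation_lt_one_iff,
    ValuationSubring.mem_nonunits_iff]
  rfl

/-- The Galois group acts transitively on the primes of the integral closure over a given prime of
`A`, so it carries one centre to the other. Each valuation ring is recovered from its centre as a
localization of the integral closure. -/
theorem exists_gal_mem_iff_mem [IsGalois F Ω] (A : ValuationSubring F)
    (O₁ O₂ : ValuationSubring Ω) (h₁ : O₁.comap (algebraMap F Ω) = A)
    (h₂ : O₂.comap (algebraMap F Ω) = A) :
    ∃ σ : Gal(Ω/F), ∀ x, x ∈ O₁ ↔ σ x ∈ O₂ := by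
  have hinv : Algebra.IsInvariant A (integralClosure A Ω) Gal(Ω/F) := by
    refine ⟨fun b hb ↦ ?_⟩
    have hfix : ∀ f : Gal(Ω/F), f (b : Ω) = b := fun f ↦ congrArg Subtype.val (hb f)
    obtain ⟨c, hc⟩ := IntermediateField.mem_bot.1 ((InfiniteGalois.mem_bot_iff_fixed _).2 hfix)
    have hcA : c ∈ A := by
      rw [← h₁]
      have := mem_of_mem_integralClosure A O₁ h₁ b.2
      rw [← hc] at this
      exact this
    exact ⟨⟨c, hcA⟩, Subtype.ext hc⟩
  -- The extension may be infinite; stabilizers of algebraic elements are open, so the profinite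
  -- group acts continuously on the discrete integral closure.
  let _ : TopologicalSpace (integralClosure A Ω) := ⊥
  have : DiscreteTopology (integralClosure A Ω) := ⟨rfl⟩
  have : ContinuousSMul Gal(Ω/F) (integralClosure A Ω) := by
    refine continuousSMul_iff_stabilizer_isOpen.2 fun b ↦ ?_
    have h := stabilizer_isOpen_of_isIntegral (K := F) (b : Ω)
    convert h using 1
    ext σ
    exact Subtype.ext_iff
  have : (centre A O₁ h₁).IsPrime := Ideal.comap_isPrime _ _
  have : (centre A O₂ h₂).IsPrime := Ideal.comap_isPrime _ _
  have hunder : ∀ (O : ValuationSubring Ω) (h : O.comap (algebraMap F Ω) = A) (a : A),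
      a ∈ (centre A O h).under A ↔ (a : F) ∈ A.nonunits := by
    intro O h a
    rw [Ideal.under, Ideal.mem_comap, mem_centre]
    change algebraMap F Ω a ∈ O.nonunits ↔ _
    have h' : ((a : F)⁻¹ ∈ A) ↔ (algebraMap F Ω a)⁻¹ ∈ O := by
      rw [← map_inv₀, ← ValuationSubring.mem_comap, h]
    rw [mem_nonunits_iff_inv_notMem, mem_nonunits_iff_inv_notMem, h', map_eq_zero]
  obtain ⟨σ, hσ⟩ := Algebra.IsInvariant.exists_smul_of_under_eq_of_profinite (G := Gal(Ω/F))
    (A := A) (centre A O₁ h₁) (centre A O₂ h₂) (by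
      ext a
      rw [hunder, hunder])
  have hσ' : ∀ c : integralClosure A Ω, (c : Ω) ∈ O₁.nonunits ↔ σ c ∈ O₂.nonunits := by
    intro c
    have := Ideal.smul_mem_pointwise_smul_iff (a := σ) (S := centre A O₁ h₁) (x := c)
    rw [← hσ, mem_centre, mem_centre] at this
    exact this.symm
  -- Write `x` as `(y * x) / y` with both terms integral over `A` and `y` outside the centre of `O`;
  -- then `τ y` lies outside the centre of `O'`.
  have aux : ∀ (O O' : ValuationSubring Ω) (h : O.comap (algebraMap F Ω) = A)
      (h' : O'.comap (algebraMap F Ω) = A) (τ : Gal(Ω/F)),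
      (∀ c : integralClosure A Ω, (c : Ω) ∈ O.nonunits ↔ τ c ∈ O'.nonunits) →
      ∀ x, x ∈ O → τ x ∈ O' := by
    intro O O' h h' τ hτ x hx
    obtain ⟨y, hy, hyx, hy0, hyO⟩ := exists_mem_integralClosure_mul_mem A O h
      (Algebra.IsAlgebraic.isAlgebraic x) hx
    have hy1 : y ∉ O.nonunits := by
      rw [ValuationSubring.mem_nonunits_iff, not_lt]
      rw [← O.valuation_le_one_iff, map_inv₀] at hyO
      exact (inv_le_one₀ (zero_lt_iff.2 ((_root_.map_ne_zero _).2 hy0))).1 hyO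
    rw [hτ ⟨y, hy⟩, ValuationSubring.mem_nonunits_iff, not_lt] at hy1
    have hyx' : τ (y * x) ∈ O' := mem_of_mem_integralClosure A O' h'
      (τ • (⟨y * x, hyx⟩ : integralClosure A Ω)).2
    have : τ x = τ (y * x) * (τ y)⁻¹ := by
      rw [map_mul, mul_comm (τ y), mul_assoc, mul_inv_cancel₀ (by simpa using hy0), mul_one]
    rw [this]
    refine mul_mem hyx' ?_
    rw [← O'.valuation_le_one_iff, map_inv₀]
    exact inv_le_one_of_one_le₀ hy1
  refine ⟨σ, fun x ↦ ⟨aux O₁ O₂ h₁ h₂ σ hσ' x, fun hx ↦ ?_⟩⟩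
  have := aux O₂ O₁ h₂ h₁ σ⁻¹ (fun c ↦ ?_) (σ x) hx
  · simpa using this
  · have h := hσ' (σ⁻¹ • c)
    have h1 : ((σ⁻¹ • c : integralClosure A Ω) : Ω) = σ⁻¹ (c : Ω) := rfl
    rw [h1] at h
    rw [h]
    exact iff_of_eq (congrArg (· ∈ O₂.nonunits) (σ.apply_symm_apply (c : Ω)).symm)

/-- Two valuations on a Galois extension that are equivalent on the base field are conjugate. -/
theorem exists_gal_valuation_le_iff [IsGalois F Ω] {Γ : Type u}
    [LinearOrderedAddCommGroupWithTop Γ] (w₁ w₂ : AddValuation Ω Γ)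
    (h : ∀ x y : F, w₁ (algebraMap F Ω x) ≤ w₁ (algebraMap F Ω y) ↔
      w₂ (algebraMap F Ω x) ≤ w₂ (algebraMap F Ω y)) :
    ∃ σ : Gal(Ω/F), ∀ x y, w₁ x ≤ w₁ y ↔ w₂ (σ x) ≤ w₂ (σ y) := by
  have hcomap : (addValuationSubring w₂).comap (algebraMap F Ω) =
      (addValuationSubring w₁).comap (algebraMap F Ω) := by
    ext x
    rw [ValuationSubring.mem_comap, ValuationSubring.mem_comap, mem_addValuationSubring,
      mem_addValuationSubring]
    simpa using (h 1 x).symm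
  obtain ⟨σ, hσ⟩ := exists_gal_mem_iff_mem _ (addValuationSubring w₁) (addValuationSubring w₂)
    rfl hcomap
  refine ⟨σ, fun x y ↦ ?_⟩
  by_cases hx : x = 0
  · simp [hx, AddValuation.top_iff]
  · rw [addValuation_le_iff w₁ hx, addValuation_le_iff w₂ (by simpa using hx), hσ, map_div₀]

end Conjugacy

/-! ### Extending pairs of embeddings with equivalent valuations. -/

section Pairs

variable {K Γ : Type u} [Field K] [LinearOrderedAddCommGroupWithTop Γ] (v : AddValuation K Γ)

theorem val_pow_le_pow_iff {x y : K} {n : ℕ} (hn : n ≠ 0) : v (x ^ n) ≤ v (y ^ n) ↔ v x ≤ v y := by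
  change v.toValuation (y ^ n) ≤ v.toValuation (x ^ n) ↔ v.toValuation y ≤ v.toValuation x
  rw [map_pow, map_pow]
  exact pow_le_pow_iff_left₀ zero_le zero_le hn

theorem val_mul_le_mul_iff {x y z : K} (hz : z ≠ 0) : v (x * z) ≤ v (y * z) ↔ v x ≤ v y := by
  rw [v.map_mul, v.map_mul, add_le_add_iff_left_of_ne_top (v.ne_top_iff.2 hz)]

theorem val_div_le_div_iff {x y z w : K} (hy : y ≠ 0) (hw : w ≠ 0) :
    v (x / y) ≤ v (z / w) ↔ v (x * w) ≤ v (z * y) := by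
  rw [← val_mul_le_mul_iff v (mul_ne_zero hy hw)]
  have h1 : x / y * (y * w) = x * w := by field_simp
  have h2 : z / w * (y * w) = z * y := by field_simp
  rw [h1, h2]

/-- Two embeddings of a field that induce equivalent valuations. -/
def SameValues {F : Type u} [Field F] (g h : F →+* K) : Prop :=
  ∀ x y, v (g x) ≤ v (g y) ↔ v (h x) ≤ v (h y)

variable {v} {F : Type u} [Field F] {g h : F →+* K}

theorem SameValues.symm (H : SameValues v g h) : SameValues v h g := fun x y ↦ (H x y).symm

theorem SameValues.lt_iff (H : SameValues v g h) (x y : F) :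
    v (g x) < v (g y) ↔ v (h x) < v (h y) := by
  rw [← not_le, ← not_le, H]

theorem SameValues.eq_iff (H : SameValues v g h) (x y : F) :
    v (g x) = v (g y) ↔ v (h x) = v (h y) := by
  rw [le_antisymm_iff, le_antisymm_iff, H, H]

/-- A pair of embeddings inducing equivalent valuations extends to the algebraic closure. -/
theorem SameValues.exists_algebraicClosure [IsAlgClosed K] (H : SameValues v g h) :
    ∃ g' h' : AlgebraicClosure F →+* K, g'.comp (algebraMap F _) = g ∧
      h'.comp (algebraMap F _) = h ∧ SameValues v g' h' := by
  have hlift : ∀ f : F →+* K, ∃ f' : AlgebraicClosure F →+* K, f'.comp (algebraMap F _) = f := by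
    intro f
    let _ := f.toAlgebra
    exact ⟨(IsAlgClosed.lift : AlgebraicClosure F →ₐ[F] K).toRingHom, AlgHom.comp_algebraMap _⟩
  obtain ⟨g₁, hg₁⟩ := hlift g
  obtain ⟨h₁, hh₁⟩ := hlift h
  -- The algebraic closure is Galois over `P` but perhaps not over `F`. Equivalence of the
  -- valuations passes from `F` to `P` because each element of `P` has a power in `F`, and powers
  -- preserve the order of values.
  let P := perfectClosure F (AlgebraicClosure F)
  have : PerfectField P := inferInstanceAs (PerfectField (perfectClosure F (AlgebraicClosure F)))
  have : Algebra.IsAlgebraic P (AlgebraicClosure F) := Algebra.IsAlgebraic.tower_top (K := F) P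
  have : IsAlgClosure P (AlgebraicClosure F) := ⟨inferInstance, inferInstance⟩
  have : IsGalois P (AlgebraicClosure F) := ⟨⟩
  obtain ⟨σ, hσ⟩ := exists_gal_valuation_le_iff (F := P) (v.comap g₁) (v.comap h₁) (by
    intro x y
    let q := ringExpChar F
    have hq : ExpChar F q := inferInstance
    obtain ⟨n, a, ha⟩ := (mem_perfectClosure_iff_pow_mem q).1 x.2
    obtain ⟨m, b, hb⟩ := (mem_perfectClosure_iff_pow_mem q).1 y.2
    have hq0 : q ^ n * q ^ m ≠ 0 := mul_ne_zero (pow_ne_zero _ (expChar_pos F q).ne')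
      (pow_ne_zero _ (expChar_pos F q).ne')
    have hx : (x : AlgebraicClosure F) ^ (q ^ n * q ^ m) = algebraMap F _ (a ^ q ^ m) := by
      rw [pow_mul, ← ha, map_pow]
    have hy : (y : AlgebraicClosure F) ^ (q ^ n * q ^ m) = algebraMap F _ (b ^ q ^ n) := by
      rw [mul_comm, pow_mul, ← hb, map_pow]
    change v (g₁ x) ≤ v (g₁ y) ↔ v (h₁ x) ≤ v (h₁ y)
    rw [← val_pow_le_pow_iff v hq0, ← val_pow_le_pow_iff v hq0 (x := h₁ x), ← map_pow, ← map_pow,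
      ← map_pow, ← map_pow, hx, hy]
    change v (g₁.comp (algebraMap F _) _) ≤ v (g₁.comp (algebraMap F _) _) ↔
      v (h₁.comp (algebraMap F _) _) ≤ v (h₁.comp (algebraMap F _) _)
    rw [hg₁, hh₁, H])
  refine ⟨g₁, h₁.comp (σ : AlgebraicClosure F →+* AlgebraicClosure F), hg₁, ?_, hσ⟩
  rw [RingHom.comp_assoc, ← hh₁]
  congr 1
  ext x
  exact σ.commutes (algebraMap F P x)

/-- A pair of embeddings extends to a transcendental element if the values of all polynomials
match. -/
theorem SameValues.exists_fractionRing {a b : K}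
    (H : ∀ P Q : F[X], v (P.eval₂ g a) ≤ v (Q.eval₂ g a) ↔ v (P.eval₂ h b) ≤ v (Q.eval₂ h b))
    (ha : ∀ P : F[X], P.eval₂ g a = 0 → P = 0) :
    ∃ g' h' : FractionRing F[X] →+* K, g'.comp (algebraMap F[X] _) = eval₂RingHom g a ∧
      h'.comp (algebraMap F[X] _) = eval₂RingHom h b ∧ SameValues v g' h' := by
  have hb : ∀ P : F[X], P.eval₂ h b = 0 → P = 0 := by
    intro P hP
    refine ha P ?_
    have := H 0 P
    simp only [eval₂_zero, hP, le_refl, iff_true, v.map_zero, top_le_iff] at this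
    exact v.top_iff.1 this
  have hga : Function.Injective (eval₂RingHom g a) := (injective_iff_map_eq_zero _).2 ha
  have hhb : Function.Injective (eval₂RingHom h b) := (injective_iff_map_eq_zero _).2 hb
  refine ⟨IsFractionRing.lift hga, IsFractionRing.lift hhb, ?_, ?_, ?_⟩
  · ext <;> simp
  · ext <;> simp
  · intro x y
    obtain ⟨p, q, hq, rfl⟩ := IsFractionRing.div_surjective (A := F[X]) x
    obtain ⟨r, s, hs, rfl⟩ := IsFractionRing.div_surjective (A := F[X]) y
    have hq0 := nonZeroDivisors.ne_zero hq
    have hs0 := nonZeroDivisors.ne_zero hs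
    simp only [map_div₀, IsFractionRing.lift_algebraMap]
    rw [val_div_le_div_iff v, val_div_le_div_iff v]
    · simp only [coe_eval₂RingHom, ← eval₂_mul, H]
    · exact fun h ↦ hq0 (hb _ h)
    · exact fun h ↦ hs0 (hb _ h)
    · exact fun h ↦ hq0 (ha _ h)
    · exact fun h ↦ hs0 (ha _ h)

variable (v g h) in
/-- The elements `a` and `b` lie in corresponding balls around points of `F` with radius in
the value group of `F`. -/
def SamePattern (a b : K) : Prop :=
  ∀ c d : F, (v (a - g c) ≤ v (g d) ↔ v (b - h c) ≤ v (h d)) ∧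
    (v (g d) ≤ v (a - g c) ↔ v (h d) ≤ v (b - h c))

theorem SamePattern.eq_iff {a b : K} (hp : SamePattern v g h a b) (c d : F) :
    v (a - g c) = v (g d) ↔ v (b - h c) = v (h d) := by
  rw [le_antisymm_iff, le_antisymm_iff, (hp c d).1, (hp c d).2]

theorem SamePattern.sub_eq_zero_iff {a b : K} (hp : SamePattern v g h a b) (c : F) :
    a - g c = 0 ↔ b - h c = 0 := by
  have := hp.eq_iff c 0
  simpa [v.top_iff] using this

/-- After cancelling the smaller power of `s`, a power `s ^ k` is compared with a quotient from `F`.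
That quotient has a `k`-th root in `F`, so the comparison becomes one of `v s` with a value from
`F`, which `hp` controls. -/
theorem SamePattern.monomial_le_iff [IsAlgClosed F] (H : SameValues v g h) {s s' : K}
    (hs : s ≠ 0) (hs' : s' ≠ 0)
    (hp : ∀ d : F, (v s ≤ v (g d) ↔ v s' ≤ v (h d)) ∧ (v (g d) ≤ v s ↔ v (h d) ≤ v s'))
    {x y : F} (hx : x ≠ 0) (hy : y ≠ 0) (n m : ℕ) :
    v (g x * s ^ n) ≤ v (g y * s ^ m) ↔ v (h x * s' ^ n) ≤ v (h y * s' ^ m) := by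
  have gen : ∀ f : F →+* K, ∀ t : K, ∀ z : F, ∀ k : ℕ, k ≠ 0 → z ^ k = y / x →
      (v (f x * t ^ k) ≤ v (f y) ↔ v t ≤ v (f z)) := by
    intro f t z k hk hz
    have hfx : f x ≠ 0 := by simpa using hx
    rw [mul_comm, ← val_pow_le_pow_iff v hk (x := t), ← map_pow, hz, map_div₀,
      ← val_mul_le_mul_iff v hfx (y := f y / f x), div_mul_cancel₀ _ hfx]
  have gen' : ∀ f : F →+* K, ∀ t : K, ∀ z : F, ∀ k : ℕ, k ≠ 0 → z ^ k = x / y →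
      (v (f x) ≤ v (f y * t ^ k) ↔ v (f z) ≤ v t) := by
    intro f t z k hk hz
    have hfy : f y ≠ 0 := by simpa using hy
    rw [mul_comm, ← val_pow_le_pow_iff v hk (y := t), ← map_pow, hz, map_div₀,
      ← val_mul_le_mul_iff v hfy (x := f x / f y), div_mul_cancel₀ _ hfy]
  rcases le_total m n with hmn | hmn
  · obtain ⟨k, rfl⟩ := Nat.exists_eq_add_of_le' hmn
    rw [pow_add, pow_add, ← mul_assoc, ← mul_assoc, val_mul_le_mul_iff v (pow_ne_zero _ hs),
      val_mul_le_mul_iff v (pow_ne_zero _ hs')]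
    rcases eq_or_ne k 0 with rfl | hk
    · simpa using H x y
    · obtain ⟨z, hz⟩ := IsAlgClosed.exists_pow_nat_eq (y / x) (Nat.pos_of_ne_zero hk)
      rw [gen g s z k hk hz, gen h s' z k hk hz, (hp z).1]
  · obtain ⟨k, rfl⟩ := Nat.exists_eq_add_of_le' hmn
    rw [pow_add, pow_add, ← mul_assoc, ← mul_assoc, val_mul_le_mul_iff v (pow_ne_zero _ hs),
      val_mul_le_mul_iff v (pow_ne_zero _ hs')]
    rcases eq_or_ne k 0 with rfl | hk
    · simpa using H x y
    · obtain ⟨z, hz⟩ := IsAlgClosed.exists_pow_nat_eq (x / y) (Nat.pos_of_ne_zero hk)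
      rw [gen' g s z k hk hz, gen' h s' z k hk hz, (hp z).2]

/-- Over an algebraically closed field, the pattern determines the values of all polynomials. -/
theorem SamePattern.eval₂_le_iff [IsAlgClosed F] (H : SameValues v g h) {a b : K}
    (hp : SamePattern v g h a b) (ha : ∀ c, a ≠ g c) (P Q : F[X]) :
    v (P.eval₂ g a) ≤ v (Q.eval₂ g a) ↔ v (P.eval₂ h b) ≤ v (Q.eval₂ h b) := by
  -- If any distance from `a` to a point of `g F` is a value not coming from `F`, then `c₀` has such
  -- a distance.
  obtain ⟨c₀, hc₀⟩ : ∃ c₀, (∃ c, ∀ d, v (a - g c) ≠ v (g d)) → ∀ d, v (a - g c₀) ≠ v (g d) := by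
    by_cases hex : ∃ c, ∀ d, v (a - g c) ≠ v (g d)
    · exact ⟨hex.choose, fun _ ↦ hex.choose_spec⟩
    · exact ⟨0, fun h ↦ absurd h hex⟩
  have hne : ∀ c, a - g c ≠ 0 := fun c ↦ sub_ne_zero.2 (ha c)
  have hne' : ∀ c, b - h c ≠ 0 := fun c hc ↦ hne c ((hp.sub_eq_zero_iff c).2 hc)
  -- A distance not in the values of `F` must equal `v (a - g c₀)`: if `g (c - c₀)` had the smaller
  -- value, it would determine the distance to `g c`.
  have lin : ∀ c, ∃ x : F, x ≠ 0 ∧ ∃ n : ℕ, v (a - g c) = v (g x * (a - g c₀) ^ n) ∧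
      v (b - h c) = v (h x * (b - h c₀) ^ n) := by
    intro c
    by_cases hc : ∃ d, v (a - g c) = v (g d)
    · obtain ⟨d, hd⟩ := hc
      refine ⟨d, ?_, 0, by simpa using hd, by simpa using (hp.eq_iff c d).1 hd⟩
      rintro rfl
      rw [map_zero, v.map_zero, v.top_iff] at hd
      exact hne c hd
    · push Not at hc
      have h0 := hc₀ ⟨c, hc⟩
      refine ⟨1, one_ne_zero, 1, ?_, ?_⟩
      all_goals simp only [map_one, pow_one, one_mul]
      · rcases lt_or_gt_of_ne (h0 (c - c₀)) with h1 | h1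
        · rw [show a - g c = (a - g c₀) - g (c - c₀) by rw [map_sub]; ring,
            v.map_sub_eq_of_lt_left h1]
        · refine absurd ?_ (hc (c - c₀))
          rw [show a - g c = (a - g c₀) - g (c - c₀) by rw [map_sub]; ring,
            v.map_sub_eq_of_lt_right h1]
      · rcases lt_or_gt_of_ne (h0 (c - c₀)) with h1 | h1
        · have h2 : v (b - h c₀) < v (h (c - c₀)) := by
            rw [← not_le, ← (hp c₀ (c - c₀)).2, not_le]
            exact h1
          rw [show b - h c = (b - h c₀) - h (c - c₀) by rw [map_sub]; ring,
            v.map_sub_eq_of_lt_left h2]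
        · refine absurd ?_ (hc (c - c₀))
          rw [show a - g c = (a - g c₀) - g (c - c₀) by rw [map_sub]; ring,
            v.map_sub_eq_of_lt_right h1]
  -- Factoring `P` over the algebraically closed `F` reduces its value to that of a monomial in `a -
  -- g c₀`, with the same coefficient and exponent on both sides.
  have poly : ∀ N : ℕ, ∀ P : F[X], P.natDegree = N → P ≠ 0 → ∃ x : F, x ≠ 0 ∧ ∃ n : ℕ,
      v (P.eval₂ g a) = v (g x * (a - g c₀) ^ n) ∧
      v (P.eval₂ h b) = v (h x * (b - h c₀) ^ n) := by
    intro N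
    induction N with
    | zero =>
      intro P hP hP0
      obtain ⟨x, rfl⟩ := natDegree_eq_zero.1 hP
      exact ⟨x, by simpa using hP0, 0, by simp, by simp⟩
    | succ N ih =>
      intro P hP hP0
      obtain ⟨c, hc⟩ := IsAlgClosed.exists_root P (by
        intro hd
        have := natDegree_eq_zero_iff_degree_le_zero.2 hd.le
        omega)
      obtain ⟨R, rfl⟩ := dvd_iff_isRoot.2 hc
      have hR0 : R ≠ 0 := right_ne_zero_of_mul hP0
      rw [natDegree_mul (X_sub_C_ne_zero c) hR0, natDegree_X_sub_C] at hP
      obtain ⟨x, hx, n, h1, h2⟩ := ih R (by omega) hR0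
      obtain ⟨y, hy, m, h3, h4⟩ := lin c
      refine ⟨y * x, mul_ne_zero hy hx, m + n, ?_, ?_⟩
      · rw [eval₂_mul, v.map_mul, h1, eval₂_sub, eval₂_X, eval₂_C, h3, ← v.map_mul, g.map_mul]
        congr 1
        ring
      · rw [eval₂_mul, v.map_mul, h2, eval₂_sub, eval₂_X, eval₂_C, h4, ← v.map_mul, h.map_mul]
        congr 1
        ring
  have nonzero : ∀ (f : F →+* K) (t : K), t ≠ 0 → ∀ x : F, x ≠ 0 → ∀ n : ℕ,
      ¬ (⊤ ≤ v (f x * t ^ n)) := by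
    intro f t ht x hx n htop
    rw [top_le_iff, v.top_iff] at htop
    exact mul_ne_zero (by simpa using hx) (pow_ne_zero n ht) htop
  by_cases hQ : Q = 0
  · simp [hQ]
  obtain ⟨y, hy, m, h3, h4⟩ := poly _ Q rfl hQ
  rw [h3, h4]
  by_cases hP : P = 0
  · rw [hP, eval₂_zero, eval₂_zero, v.map_zero]
    exact iff_of_false (nonzero g _ (hne c₀) y hy m) (nonzero h _ (hne' c₀) y hy m)
  obtain ⟨x, hx, n, h1, h2⟩ := poly _ P rfl hP
  rw [h1, h2]
  exact SamePattern.monomial_le_iff H (hne c₀) (hne' c₀) (hp c₀) hx hy n m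

/-- Elements with the same pattern are exchanged by an extension of the pair of embeddings. -/
theorem SamePattern.exists_extension [IsAlgClosed F] [Countable F] (H : SameValues v g h) {a b : K}
    (hp : SamePattern v g h a b) :
    ∃ (L : Type u) (_ : Field L) (_ : Countable L) (i : F →+* L) (g' h' : L →+* K) (e : L),
      g'.comp i = g ∧ h'.comp i = h ∧ SameValues v g' h' ∧ g' e = a ∧ h' e = b := by
  by_cases ha : ∃ c, a = g c
  · obtain ⟨c, hc⟩ := ha
    refine ⟨F, inferInstance, inferInstance, RingHom.id F, g, h, c, rfl, rfl, H, hc.symm, ?_⟩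
    exact (sub_eq_zero.1 ((hp.sub_eq_zero_iff c).1 (sub_eq_zero.2 hc))).symm
  · push Not at ha
    have key := hp.eval₂_le_iff H ha
    -- Here `a` is transcendental over `g F`: all roots of a polynomial over the algebraically
    -- closed `F` already lie in `F`.
    obtain ⟨g', h', hg', hh', H'⟩ := SameValues.exists_fractionRing key (by
      intro P hP
      by_contra hP0
      have hd : P.degree ≠ 0 := by
        intro hd
        obtain ⟨x, rfl⟩ := natDegree_eq_zero.1 (natDegree_eq_of_degree_eq_some hd)
        simp at hP
        exact hP0 (by simp [hP])
      have hs : P.Splits := IsAlgClosed.splits P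
      have hroot : (P.map g).IsRoot a := by rwa [IsRoot, eval_map]
      have := (mem_roots ((Polynomial.map_ne_zero_iff g.injective).2 hP0)).2 hroot
      rw [hs.roots_map g, Multiset.mem_map] at this
      obtain ⟨c, _, hc⟩ := this
      exact ha c hc.symm)
    refine ⟨FractionRing F[X], inferInstance, ?_, (algebraMap F[X] _).comp C, g', h',
      algebraMap F[X] _ X, ?_, ?_, H', ?_, ?_⟩
    · have : Countable F[X] := Cardinal.mk_le_aleph0_iff.1
        (Polynomial.cardinalMk_le_max.trans (max_le Cardinal.mk_le_aleph0 le_rfl))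
      refine Function.Surjective.countable
        (f := fun p : F[X] × F[X] ↦ algebraMap F[X] (FractionRing F[X]) p.1 / algebraMap _ _ p.2) ?_
      intro x
      obtain ⟨p, q, _, hx⟩ := IsFractionRing.div_surjective (A := F[X]) x
      exact ⟨(p, q), hx⟩
    · rw [← RingHom.comp_assoc, hg']
      ext x
      simp
    · rw [← RingHom.comp_assoc, hh']
      ext x
      simp
    · simpa using congrArg (fun f ↦ f X) hg'
    · simpa using congrArg (fun f ↦ f X) hh'

end Pairs

/-! ### Genericity: infinite residue field, dense value group, finite patterns. -/

section Generic

variable {K Γ : Type u} [Field K] [LinearOrderedAddCommGroupWithTop Γ]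
  (v : AddValuation K Γ)

/-- The residue field is infinite: the valuation ring is not covered by finitely many cosets of its
maximal ideal. -/
theorem exists_integral_val_sub_le [IsAlgClosed K] (U : Finset K) : ∃ x, 0 ≤ v x ∧ ∀ u ∈ U, v (x - u) ≤ 0 := by
  classical
  -- A root `x` of `∏ (X - u) + 1` makes the values `v (x - u)` sum to `0`. Inserting `0` keeps the
  -- product nonconstant. A negative `v x` would make every summand negative; hence all are
  -- nonnegative, and all vanish.
  let S := insert 0 (U.filter fun u ↦ 0 ≤ v u)
  have hS : ∀ u ∈ S, 0 ≤ v u := by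
    intro u hu
    rcases Finset.mem_insert.1 hu with rfl | hu
    · simp
    · exact (Finset.mem_filter.1 hu).2
  obtain ⟨x, hx⟩ := IsAlgClosed.exists_root (∏ u ∈ S, (X - C u) + C 1 : K[X]) (by
    have hm : (∏ u ∈ S, (X - C u) : K[X]).natDegree = S.card := by
      simp
    intro hd
    have h0 := natDegree_eq_zero_iff_degree_le_zero.2 hd.le
    rw [natDegree_add_C, hm, Finset.card_eq_zero] at h0
    exact Finset.insert_ne_empty _ _ h0)
  have hprod : ∑ u ∈ S, v (x - u) = 0 := by
    have h1 : ∏ u ∈ S, (x - u) = -1 := by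
      rw [IsRoot, eval_add, eval_prod, eval_C] at hx
      simpa using eq_neg_of_add_eq_zero_left hx
    have h2 : ∀ T : Finset K, v (∏ u ∈ T, (x - u)) = ∑ u ∈ T, v (x - u) := by
      intro T
      induction T using Finset.induction with
      | empty => simp
      | insert a T ha ih => rw [Finset.prod_insert ha, Finset.sum_insert ha, v.map_mul, ih]
    rw [← h2, h1, v.map_neg, v.map_one]
  have hx0 : 0 ≤ v x := by
    by_contra hneg
    rw [not_le] at hneg
    have h3 : ∀ u ∈ S, v (x - u) = v x := fun u hu ↦
      v.map_sub_eq_of_lt_left (hneg.trans_le (hS u hu))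
    rw [Finset.sum_congr rfl h3, Finset.sum_const] at hprod
    have hc : S.card ≠ 0 := by simp [S]
    have : S.card • v x < 0 := by
      have h4 : S.card • v x ≤ v x := by
        obtain ⟨n, hn⟩ := Nat.exists_eq_succ_of_ne_zero hc
        rw [hn, succ_nsmul]
        calc n • v x + v x ≤ 0 + v x := by gcongr; exact nsmul_nonpos hneg.le n
          _ = v x := zero_add _
      exact h4.trans_lt hneg
    exact this.ne hprod
  have hnn : ∀ u ∈ S, 0 ≤ v (x - u) := fun u hu ↦ v.map_le_sub hx0 (hS u hu)
  refine ⟨x, hx0, fun u hu ↦ ?_⟩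
  by_cases hu0 : 0 ≤ v u
  · have := (Finset.sum_eq_zero_iff_of_nonneg hnn).1 hprod u
      (Finset.mem_insert_of_mem (Finset.mem_filter.2 ⟨hu, hu0⟩))
    exact this.le
  · rw [not_le] at hu0
    rw [v.map_sub_eq_of_lt_right (hu0.trans_le hx0)]
    exact hu0.le

/-- The previous lemma transported by `t ↦ a + t * s`: a closed ball has a point no closer than its
radius to any of finitely many given points. -/
theorem exists_val_sub_le [IsAlgClosed K] (U : Finset K) (a : K) {s : K} (hs : s ≠ 0) :
    ∃ x, v s ≤ v (x - a) ∧ ∀ u ∈ U, v (x - u) ≤ v s := by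
  classical
  obtain ⟨t, ht, htU⟩ := exists_integral_val_sub_le v (U.image fun u ↦ (u - a) / s)
  refine ⟨a + t * s, ?_, fun u hu ↦ ?_⟩
  · rw [add_sub_cancel_left]
    simpa using (val_mul_le_mul_iff v hs (x := 1) (y := t)).2 (by simpa using ht)
  · have := htU _ (Finset.mem_image_of_mem _ hu)
    rw [← v.map_one, ← val_mul_le_mul_iff v hs, one_mul, sub_mul, div_mul_cancel₀ _ hs] at this
    convert this using 2
    ring

variable {v}

theorem exists_val_pos (hv : ∃ x : K, x ≠ 0 ∧ v x ≠ 0) : ∃ t : K, t ≠ 0 ∧ 0 < v t := by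
  obtain ⟨x, hx, hvx⟩ := hv
  rcases lt_or_gt_of_ne hvx with h | h
  · refine ⟨x⁻¹, inv_ne_zero hx, ?_⟩
    by_contra hneg
    have h0 : v x + v x⁻¹ = 0 := by rw [← v.map_mul, mul_inv_cancel₀ hx, v.map_one]
    have h1 : v x + v x⁻¹ < 0 := by
      calc v x + v x⁻¹ ≤ v x + 0 := by gcongr; exact not_lt.1 hneg
        _ = v x := add_zero _
        _ < 0 := h
    exact h1.ne h0
  · exact ⟨x, hx, h⟩

theorem val_lt_val_mul {t p : K} (ht : 0 < v t) (hp : p ≠ 0) : v p < v (t * p) := by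
  rw [v.map_mul]
  calc v p = 0 + v p := (zero_add _).symm
    _ < v t + v p := (add_lt_add_iff_left_of_ne_top (v.ne_top_iff.2 hp)).2 ht

theorem exists_val_lt (hv : ∃ x : K, x ≠ 0 ∧ v x ≠ 0) (q : K) : ∃ x : K, x ≠ 0 ∧ v x < v q := by
  obtain ⟨t, ht, hvt⟩ := exists_val_pos hv
  by_cases hq : q = 0
  · exact ⟨1, one_ne_zero, by simp [hq]⟩
  · refine ⟨t⁻¹ * q, mul_ne_zero (inv_ne_zero ht) hq, ?_⟩
    simpa [ht] using val_lt_val_mul hvt (mul_ne_zero (inv_ne_zero ht) hq)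

/-- The value group is densely ordered. -/
theorem exists_val_between [IsAlgClosed K] (hv : ∃ x : K, x ≠ 0 ∧ v x ≠ 0) {p q : K} (h : v p < v q) :
    ∃ x : K, x ≠ 0 ∧ v p < v x ∧ v x < v q := by
  obtain ⟨t, ht, hvt⟩ := exists_val_pos hv
  have hp : p ≠ 0 := v.ne_top_iff.1 (h.trans_le le_top).ne
  by_cases hq : q = 0
  · refine ⟨t * p, mul_ne_zero ht hp, val_lt_val_mul hvt hp, ?_⟩
    rw [hq, v.map_zero, lt_top_iff_ne_top, v.ne_top_iff]
    exact mul_ne_zero ht hp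
  -- The value of a square root of `p * q` is the midpoint of the two values.
  · obtain ⟨x, hx⟩ := IsAlgClosed.exists_pow_nat_eq (p * q) (n := 2) two_pos
    have hx0 : x ≠ 0 := by
      rintro rfl
      rw [zero_pow two_ne_zero] at hx
      exact mul_ne_zero hp hq hx.symm
    refine ⟨x, hx0, ?_, ?_⟩
    · rw [← not_le, ← val_pow_le_pow_iff v two_ne_zero, hx, sq, mul_comm p q,
        val_mul_le_mul_iff v hp, not_le]
      exact h
    · rw [← not_le, ← val_pow_le_pow_iff v two_ne_zero, hx, sq, val_mul_le_mul_iff v hq, not_le]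
      exact h

variable {F : Type u} [Field F] {g h : F →+* K}

/-- Finite cuts in the value group are realized on the other side. -/
theorem SameValues.exists_cut [IsAlgClosed K] (hv : ∃ x : K, x ≠ 0 ∧ v x ≠ 0) (H : SameValues v g h)
    (E : Finset F) {s : K} (hs : s ≠ 0) :
    ∃ s' : K, s' ≠ 0 ∧ ∀ e ∈ E, (v s ≤ v (g e) ↔ v s' ≤ v (h e)) ∧
      (v (g e) ≤ v s ↔ v (h e) ≤ v s') := by
  classical
  by_cases hE : ∃ e, v (g e) = v s
  · obtain ⟨e, he⟩ := hE
    refine ⟨h e, fun h0 ↦ hs ?_, fun d _ ↦ ?_⟩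
    · rw [map_eq_zero] at h0
      rwa [h0, map_zero, v.map_zero, eq_comm, v.top_iff] at he
    · rw [← he]
      exact ⟨H e d, H d e⟩
  push Not at hE
  suffices hsuff : ∃ s' : K, s' ≠ 0 ∧ (∀ e ∈ E, v (g e) < v s → v (h e) < v s') ∧
      (∀ e ∈ E, v s < v (g e) → v s' < v (h e)) by
    obtain ⟨s', hs', h1, h2⟩ := hsuff
    refine ⟨s', hs', fun e he ↦ ?_⟩
    rcases lt_or_gt_of_ne (hE e) with h3 | h3
    · have h4 := h1 e he h3
      exact ⟨iff_of_false h3.not_ge h4.not_ge, iff_of_true h3.le h4.le⟩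
    · have h4 := h2 e he h3
      exact ⟨iff_of_true h3.le h4.le, iff_of_false h3.not_ge h4.not_ge⟩
  have hs_top : v s < v (g 0) := by
    rw [map_zero, v.map_zero, lt_top_iff_ne_top, v.ne_top_iff]
    exact hs
  -- Including `0`, of value `⊤`, guarantees an upper bound of the cut even when `E` supplies none.
  obtain ⟨q, hq, hqmin⟩ := ((insert 0 E).filter fun e ↦ v s < v (g e)).exists_min_image
    (fun e ↦ v (h e)) ⟨0, Finset.mem_filter.2 ⟨Finset.mem_insert_self _ _, hs_top⟩⟩
  have hq' := (Finset.mem_filter.1 hq).2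
  have hup : ∀ e ∈ E, v s < v (g e) → v (h q) ≤ v (h e) := fun e he h1 ↦
    hqmin e (Finset.mem_filter.2 ⟨Finset.mem_insert_of_mem he, h1⟩)
  by_cases hL : (E.filter fun e ↦ v (g e) < v s).Nonempty
  · obtain ⟨p, hp, hpmax⟩ := Finset.exists_max_image _ (fun e ↦ v (h e)) hL
    obtain ⟨x, hx, hx1, hx2⟩ := exists_val_between hv
      ((H.lt_iff p q).1 ((Finset.mem_filter.1 hp).2.trans hq'))
    exact ⟨x, hx, fun e he h1 ↦ (hpmax e (Finset.mem_filter.2 ⟨he, h1⟩)).trans_lt hx1,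
      fun e he h1 ↦ hx2.trans_le (hup e he h1)⟩
  · obtain ⟨x, hx, hx1⟩ := exists_val_lt hv (h q)
    refine ⟨x, hx, fun e he h1 ↦ absurd ⟨e, Finset.mem_filter.2 ⟨he, h1⟩⟩ hL,
      fun e he h1 ↦ hx1.trans_le (hup e he h1)⟩

/-- Every finite part of the pattern of an element is realized on the other side. -/
theorem SameValues.exists_finite_pattern [IsAlgClosed K] (hv : ∃ x : K, x ≠ 0 ∧ v x ≠ 0) (H : SameValues v g h)
    (a : K) (T D : Finset F) :
    ∃ b : K, ∀ c ∈ T, ∀ d ∈ D, (v (a - g c) ≤ v (g d) ↔ v (b - h c) ≤ v (h d)) ∧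
      (v (g d) ≤ v (a - g c) ↔ v (h d) ≤ v (b - h c)) := by
  classical
  by_cases ha : ∃ c, a = g c
  · obtain ⟨e, rfl⟩ := ha
    refine ⟨h e, fun c _ d _ ↦ ?_⟩
    rw [← map_sub, ← map_sub]
    exact ⟨H _ _, H _ _⟩
  push Not at ha
  rcases T.eq_empty_or_nonempty with rfl | hT
  · exact ⟨0, by simp⟩
  -- With `c₀` the centre nearest to `a`, every distance is determined by `v (a - g c) = min (v (a -
  -- g c₀)) (v (g (c - c₀)))`.
  obtain ⟨c₀, _, hmax⟩ := T.exists_max_image (fun c ↦ v (a - g c)) hT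
  obtain ⟨s', hs', hcut⟩ := H.exists_cut hv (D ∪ T.image fun c ↦ c - c₀)
    (sub_ne_zero.2 (ha c₀))
  -- The element `t` has value at least `v s'` but is generic with respect to the other centres, so
  -- `h c₀ + t` obeys the same minimum formula with `s'` for `a - g c₀`.
  obtain ⟨t, ht, htU⟩ := exists_val_sub_le v (T.image fun c ↦ h (c - c₀)) 0 hs'
  rw [sub_zero] at ht
  refine ⟨h c₀ + t, fun c hc d hd ↦ ?_⟩
  have hcut_c := hcut (c - c₀) (Finset.mem_union_right _ (Finset.mem_image_of_mem _ hc))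
  have hcut_d := hcut d (Finset.mem_union_left _ hd)
  have e1 : v (a - g c) = min (v (a - g c₀)) (v (g (c - c₀))) := by
    have hsub : a - g c = (a - g c₀) - g (c - c₀) := by rw [map_sub]; ring
    refine le_antisymm (le_min (hmax c hc) ?_) (by rw [hsub]; exact v.map_sub _ _)
    by_contra hlt
    rw [not_le] at hlt
    have h2 : v (g (c - c₀)) < v (a - g c₀) := hlt.trans_le (hmax c hc)
    rw [hsub, v.map_sub_eq_of_lt_right h2] at hlt
    exact hlt.false
  have e2 : v (h c₀ + t - h c) = min (v s') (v (h (c - c₀))) := by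
    have hsub : h c₀ + t - h c = t - h (c - c₀) := by rw [map_sub]; ring
    rw [hsub]
    have hle := htU _ (Finset.mem_image_of_mem _ hc)
    refine le_antisymm (le_min hle ?_) ((min_le_min_right _ ht).trans (v.map_sub _ _))
    by_contra hlt
    rw [not_le] at hlt
    have h2 : v (h (c - c₀)) < v t := (hlt.trans_le hle).trans_le ht
    rw [v.map_sub_eq_of_lt_right h2] at hlt
    exact hlt.false
  rw [e1, e2, min_le_iff, min_le_iff, le_min_iff, le_min_iff, hcut_d.1, hcut_d.2, H, H]
  exact ⟨Iff.rfl, Iff.rfl⟩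

end Generic

/-! ### Definable sets and preservation of formulas by back-and-forth. -/

section Formulas

variable {K Γ : Type u} [Field K] [LinearOrderedAddCommGroupWithTop Γ] (v : AddValuation K Γ)

theorem definable_iff (X : Set K) :
    Definable v X ↔ ∃ φ : VFormula (Set.univ : Set K) (Set.univ : Set Γ) 1 0,
      ∀ x y, φ.Realize v x y ↔ x 0 ∈ X := by
  constructor
  · rintro ⟨φ, hφ⟩
    exact ⟨φ, fun x y ↦ (Set.ext_iff.1 hφ (x, y)).symm⟩
  · rintro ⟨φ, hφ⟩
    exact ⟨φ, Set.ext fun p ↦ (hφ p.1 p.2).symm⟩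

variable {v}

theorem Definable.compl {X : Set K} (hX : Definable v X) : Definable v Xᶜ := by
  rw [definable_iff] at hX ⊢
  obtain ⟨φ, hφ⟩ := hX
  exact ⟨.not φ, fun x y ↦ not_congr (hφ x y)⟩

theorem Definable.inter {X Y : Set K} (hX : Definable v X) (hY : Definable v Y) :
    Definable v (X ∩ Y) := by
  rw [definable_iff] at hX hY ⊢
  obtain ⟨φ, hφ⟩ := hX
  obtain ⟨ψ, hψ⟩ := hY
  exact ⟨.and φ ψ, fun x y ↦ and_congr (hφ x y) (hψ x y)⟩

variable (v) in
theorem definable_univ : Definable v (Set.univ : Set K) := by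
  rw [definable_iff]
  exact ⟨.eqField .zero .zero, fun x y ↦ iff_of_true rfl trivial⟩

theorem definable_biInter {ι : Type*} (J : Finset ι) {S : ι → Set K}
    (hS : ∀ i ∈ J, Definable v (S i)) : Definable v (⋂ i ∈ J, S i) := by
  classical
  induction J using Finset.induction with
  | empty => simpa using definable_univ v
  | insert a J ha ih =>
    rw [Finset.set_biInter_insert]
    exact (hS a (Finset.mem_insert_self _ _)).inter
      (ih fun i hi ↦ hS i (Finset.mem_insert_of_mem hi))

theorem definable_biUnion {ι : Type*} (J : Finset ι) {S : ι → Set K}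
    (hS : ∀ i ∈ J, Definable v (S i)) : Definable v (⋃ i ∈ J, S i) := by
  rw [← compl_compl (⋃ i ∈ J, S i)]
  simp only [Set.compl_iUnion]
  exact (definable_biInter J fun i hi ↦ (hS i hi).compl).compl

variable (v) in
theorem definable_val_sub_le (c : K) (r : Γ) : Definable v {x | v (x - c) ≤ r} := by
  rw [definable_iff]
  refine ⟨.leValue (.val (.add (.var 0) (.neg (.param ⟨c, trivial⟩)))) (.param ⟨r, trivial⟩),
    fun x y ↦ ?_⟩
  rw [Set.mem_ofPred_eq, sub_eq_add_neg]
  exact Iff.rfl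

variable (v) in
theorem definable_le_val_sub (c : K) (r : Γ) : Definable v {x | r ≤ v (x - c)} := by
  rw [definable_iff]
  refine ⟨.leValue (.param ⟨r, trivial⟩) (.val (.add (.var 0) (.neg (.param ⟨c, trivial⟩)))),
    fun x y ↦ ?_⟩
  rw [Set.mem_ofPred_eq, sub_eq_add_neg]
  exact Iff.rfl

theorem Definable.iff_const {X : Set K} (hX : Definable v X) (p : Prop) :
    Definable v {x | p ↔ x ∈ X} := by
  by_cases hp : p
  · simpa [hp] using hX
  · have : {x | p ↔ x ∈ X} = Xᶜ := by
      ext x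
      simp [hp]
    rw [this]
    exact hX.compl

/-! ### Parameters and variables -/

theorem FieldTerm.exists_finite_params {A : Set K} {n : ℕ} (t : FieldTerm A n) :
    ∃ A₀ : Set K, A₀ ⊆ A ∧ A₀.Finite ∧ ∀ B, A₀ ⊆ B → ∃ s : FieldTerm B n,
      ∀ x, s.realize x = t.realize x := by
  induction t with
  | var i => exact ⟨∅, Set.empty_subset _, Set.finite_empty, fun B _ ↦ ⟨.var i, fun _ ↦ rfl⟩⟩
  | param a =>
    exact ⟨{a.1}, Set.singleton_subset_iff.2 a.2, Set.finite_singleton _,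
      fun B hB ↦ ⟨.param ⟨a, hB rfl⟩, fun _ ↦ rfl⟩⟩
  | zero => exact ⟨∅, Set.empty_subset _, Set.finite_empty, fun B _ ↦ ⟨.zero, fun _ ↦ rfl⟩⟩
  | one => exact ⟨∅, Set.empty_subset _, Set.finite_empty, fun B _ ↦ ⟨.one, fun _ ↦ rfl⟩⟩
  | neg s ih =>
    obtain ⟨A₁, hA, hf, h⟩ := ih
    refine ⟨A₁, hA, hf, fun B hB ↦ ?_⟩
    obtain ⟨s', hs'⟩ := h B hB
    exact ⟨.neg s', fun x ↦ congrArg _ (hs' x)⟩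
  | add s t ih₁ ih₂ =>
    obtain ⟨A₁, hA₁, hf₁, h₁⟩ := ih₁
    obtain ⟨A₂, hA₂, hf₂, h₂⟩ := ih₂
    refine ⟨A₁ ∪ A₂, Set.union_subset hA₁ hA₂, hf₁.union hf₂, fun B hB ↦ ?_⟩
    obtain ⟨s', hs'⟩ := h₁ B (Set.subset_union_left.trans hB)
    obtain ⟨t', ht'⟩ := h₂ B (Set.subset_union_right.trans hB)
    exact ⟨.add s' t', fun x ↦ congrArg₂ _ (hs' x) (ht' x)⟩
  | mul s t ih₁ ih₂ =>
    obtain ⟨A₁, hA₁, hf₁, h₁⟩ := ih₁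
    obtain ⟨A₂, hA₂, hf₂, h₂⟩ := ih₂
    refine ⟨A₁ ∪ A₂, Set.union_subset hA₁ hA₂, hf₁.union hf₂, fun B hB ↦ ?_⟩
    obtain ⟨s', hs'⟩ := h₁ B (Set.subset_union_left.trans hB)
    obtain ⟨t', ht'⟩ := h₂ B (Set.subset_union_right.trans hB)
    exact ⟨.mul s' t', fun x ↦ congrArg₂ _ (hs' x) (ht' x)⟩

variable (v) in
theorem ValueTerm.exists_finite_params {A : Set K} {C : Set Γ} {n m : ℕ}
    (t : ValueTerm A C n m) :
    ∃ (A₀ : Set K) (C₀ : Set Γ), A₀.Finite ∧ C₀.Finite ∧ ∀ B D, A₀ ⊆ B → C₀ ⊆ D →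
      ∃ s : ValueTerm B D n m, ∀ x y, s.realize v x y = t.realize v x y := by
  induction t with
  | var i =>
    exact ⟨∅, ∅, Set.finite_empty, Set.finite_empty, fun B D _ _ ↦ ⟨.var i, fun _ _ ↦ rfl⟩⟩
  | param c =>
    exact ⟨∅, {c.1}, Set.finite_empty, Set.finite_singleton _,
      fun B D _ hD ↦ ⟨.param ⟨c, hD rfl⟩, fun _ _ ↦ rfl⟩⟩
  | val t =>
    obtain ⟨A₁, _, hf, h⟩ := t.exists_finite_params
    refine ⟨A₁, ∅, hf, Set.finite_empty, fun B D hB _ ↦ ?_⟩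
    obtain ⟨s, hs⟩ := h B hB
    exact ⟨.val s, fun x _ ↦ congrArg v (hs x)⟩
  | infty =>
    exact ⟨∅, ∅, Set.finite_empty, Set.finite_empty, fun B D _ _ ↦ ⟨.infty, fun _ _ ↦ rfl⟩⟩
  | zero =>
    exact ⟨∅, ∅, Set.finite_empty, Set.finite_empty, fun B D _ _ ↦ ⟨.zero, fun _ _ ↦ rfl⟩⟩
  | neg s ih =>
    obtain ⟨A₁, C₁, hf, hf', h⟩ := ih
    refine ⟨A₁, C₁, hf, hf', fun B D hB hD ↦ ?_⟩
    obtain ⟨s', hs'⟩ := h B D hB hD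
    exact ⟨.neg s', fun x y ↦ congrArg _ (hs' x y)⟩
  | add s t ih₁ ih₂ =>
    obtain ⟨A₁, C₁, hA₁, hC₁, h₁⟩ := ih₁
    obtain ⟨A₂, C₂, hA₂, hC₂, h₂⟩ := ih₂
    refine ⟨A₁ ∪ A₂, C₁ ∪ C₂, hA₁.union hA₂, hC₁.union hC₂, fun B D hB hD ↦ ?_⟩
    obtain ⟨s', hs'⟩ := h₁ B D (Set.subset_union_left.trans hB) (Set.subset_union_left.trans hD)
    obtain ⟨t', ht'⟩ := h₂ B D (Set.subset_union_right.trans hB) (Set.subset_union_right.trans hD)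
    exact ⟨.add s' t', fun x y ↦ congrArg₂ _ (hs' x y) (ht' x y)⟩

variable (v) in
/-- A formula uses only finitely many parameters. -/
theorem VFormula.exists_finite_params {A : Set K} {C : Set Γ} {n m : ℕ} (φ : VFormula A C n m) :
    ∃ (A₀ : Set K) (C₀ : Set Γ), A₀.Finite ∧ C₀.Finite ∧ ∀ B D, A₀ ⊆ B → C₀ ⊆ D →
      ∃ ψ : VFormula B D n m, ∀ x y, ψ.Realize v x y ↔ φ.Realize v x y := by
  induction φ with
  | eqField s t =>
    obtain ⟨A₁, -, hA₁, h₁⟩ := s.exists_finite_params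
    obtain ⟨A₂, -, hA₂, h₂⟩ := t.exists_finite_params
    refine ⟨A₁ ∪ A₂, ∅, hA₁.union hA₂, Set.finite_empty, fun B D hB hD ↦ ?_⟩
    obtain ⟨s', hs'⟩ := h₁ B (Set.subset_union_left.trans hB)
    obtain ⟨t', ht'⟩ := h₂ B (Set.subset_union_right.trans hB)
    exact ⟨.eqField s' t', fun x y ↦ by simp only [VFormula.Realize, hs', ht']⟩
  | eqValue s t =>
    obtain ⟨A₁, C₁, hA₁, hC₁, h₁⟩ := s.exists_finite_params v
    obtain ⟨A₂, C₂, hA₂, hC₂, h₂⟩ := t.exists_finite_params v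
    refine ⟨A₁ ∪ A₂, C₁ ∪ C₂, hA₁.union hA₂, hC₁.union hC₂, fun B D hB hD ↦ ?_⟩
    obtain ⟨s', hs'⟩ := h₁ B D (Set.subset_union_left.trans hB) (Set.subset_union_left.trans hD)
    obtain ⟨t', ht'⟩ := h₂ B D (Set.subset_union_right.trans hB) (Set.subset_union_right.trans hD)
    exact ⟨.eqValue s' t', fun x y ↦ by simp only [VFormula.Realize, hs', ht']⟩
  | leValue s t =>
    obtain ⟨A₁, C₁, hA₁, hC₁, h₁⟩ := s.exists_finite_params v
    obtain ⟨A₂, C₂, hA₂, hC₂, h₂⟩ := t.exists_finite_params v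
    refine ⟨A₁ ∪ A₂, C₁ ∪ C₂, hA₁.union hA₂, hC₁.union hC₂, fun B D hB hD ↦ ?_⟩
    obtain ⟨s', hs'⟩ := h₁ B D (Set.subset_union_left.trans hB) (Set.subset_union_left.trans hD)
    obtain ⟨t', ht'⟩ := h₂ B D (Set.subset_union_right.trans hB) (Set.subset_union_right.trans hD)
    exact ⟨.leValue s' t', fun x y ↦ by simp only [VFormula.Realize, hs', ht']⟩
  | not φ ih =>
    obtain ⟨A₁, C₁, hA, hC, h⟩ := ih
    refine ⟨A₁, C₁, hA, hC, fun B D hB hD ↦ ?_⟩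
    obtain ⟨ψ, hψ⟩ := h B D hB hD
    exact ⟨.not ψ, fun x y ↦ not_congr (hψ x y)⟩
  | and φ ψ ih₁ ih₂ =>
    obtain ⟨A₁, C₁, hA₁, hC₁, h₁⟩ := ih₁
    obtain ⟨A₂, C₂, hA₂, hC₂, h₂⟩ := ih₂
    refine ⟨A₁ ∪ A₂, C₁ ∪ C₂, hA₁.union hA₂, hC₁.union hC₂, fun B D hB hD ↦ ?_⟩
    obtain ⟨s', hs'⟩ := h₁ B D (Set.subset_union_left.trans hB) (Set.subset_union_left.trans hD)
    obtain ⟨t', ht'⟩ := h₂ B D (Set.subset_union_right.trans hB) (Set.subset_union_right.trans hD)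
    exact ⟨.and s' t', fun x y ↦ and_congr (hs' x y) (ht' x y)⟩
  | exField φ ih =>
    obtain ⟨A₁, C₁, hA, hC, h⟩ := ih
    refine ⟨A₁, C₁, hA, hC, fun B D hB hD ↦ ?_⟩
    obtain ⟨ψ, hψ⟩ := h B D hB hD
    exact ⟨.exField ψ, fun x y ↦ exists_congr fun a ↦ hψ _ y⟩
  | exValue φ ih =>
    obtain ⟨A₁, C₁, hA, hC, h⟩ := ih
    refine ⟨A₁, C₁, hA, hC, fun B D hB hD ↦ ?_⟩
    obtain ⟨ψ, hψ⟩ := h B D hB hD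
    exact ⟨.exValue ψ, fun x y ↦ exists_congr fun a ↦ hψ x _⟩

/-- Renaming of the variables of a field term. -/
def FieldTerm.rename {A : Set K} {n n' : ℕ} (σ : Fin n → Fin n') : FieldTerm A n → FieldTerm A n'
  | .var i => .var (σ i)
  | .param a => .param a
  | .zero => .zero
  | .one => .one
  | .neg s => .neg (s.rename σ)
  | .add s t => .add (s.rename σ) (t.rename σ)
  | .mul s t => .mul (s.rename σ) (t.rename σ)

omit [LinearOrderedAddCommGroupWithTop Γ] in
theorem FieldTerm.realize_rename {A : Set K} {n n' : ℕ} (σ : Fin n → Fin n') (x : Fin n' → K)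
    (t : FieldTerm A n) : (t.rename σ).realize x = t.realize (x ∘ σ) := by
  induction t <;> simp_all [FieldTerm.rename, FieldTerm.realize]

/-- Renaming of the field variables of a value term. -/
def ValueTerm.rename {A : Set K} {C : Set Γ} {n n' m : ℕ} (σ : Fin n → Fin n') :
    ValueTerm A C n m → ValueTerm A C n' m
  | .var i => .var i
  | .param a => .param a
  | .val t => .val (t.rename σ)
  | .infty => .infty
  | .zero => .zero
  | .neg s => .neg (s.rename σ)
  | .add s t => .add (s.rename σ) (t.rename σ)

variable (v) in
theorem ValueTerm.realize_rename {A : Set K} {C : Set Γ} {n n' m : ℕ} (σ : Fin n → Fin n')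
    (x : Fin n' → K) (y : Fin m → Γ) (t : ValueTerm A C n m) :
    (t.rename σ).realize v x y = t.realize v (x ∘ σ) y := by
  induction t <;> simp_all [ValueTerm.rename, ValueTerm.realize, FieldTerm.realize_rename]

/-- Renaming of the field variables of a formula. -/
def VFormula.rename {A : Set K} {C : Set Γ} : {n n' m : ℕ} → (Fin n → Fin n') →
    VFormula A C n m → VFormula A C n' m
  | _, _, _, σ, .eqField s t => .eqField (s.rename σ) (t.rename σ)
  | _, _, _, σ, .eqValue s t => .eqValue (s.rename σ) (t.rename σ)
  | _, _, _, σ, .leValue s t => .leValue (s.rename σ) (t.rename σ)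
  | _, _, _, σ, .not φ => .not (φ.rename σ)
  | _, _, _, σ, .and φ ψ => .and (φ.rename σ) (ψ.rename σ)
  | _, _, _, σ, .exField φ => .exField (φ.rename (Fin.cons 0 (Fin.succ ∘ σ)))
  | _, _, _, σ, .exValue φ => .exValue (φ.rename σ)

variable (v) in
theorem VFormula.realize_rename {A : Set K} {C : Set Γ} {n m : ℕ} (φ : VFormula A C n m) :
    ∀ {n' : ℕ} (σ : Fin n → Fin n') (x : Fin n' → K) (y : Fin m → Γ),
      (φ.rename σ).Realize v x y ↔ φ.Realize v (x ∘ σ) y := by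
  induction φ with
  | eqField s t => intros; simp [rename, Realize, FieldTerm.realize_rename]
  | eqValue s t => intros; simp [rename, Realize, ValueTerm.realize_rename]
  | leValue s t => intros; simp [rename, Realize, ValueTerm.realize_rename]
  | not φ ih => intros; simp [rename, Realize, ih]
  | and φ ψ ih₁ ih₂ => intros; simp [rename, Realize, ih₁, ih₂]
  | exField φ ih =>
    intro n' σ x y
    simp only [rename, Realize, ih]
    refine exists_congr fun a ↦ ?_
    have : (Fin.cons a x : Fin (n' + 1) → K) ∘ (Fin.cons 0 (Fin.succ ∘ σ)) = Fin.cons a (x ∘ σ) := by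
      funext i
      refine Fin.cases ?_ (fun j ↦ ?_) i <;> simp
    rw [this]
  | exValue φ ih => intros; simp [rename, Realize, ih]

variable (v) in
/-- Saturation for countably many definable subsets of the field. -/
def CountablySaturated : Prop :=
  ∀ (ι : Type u) [Countable ι] (S : ι → Set K), (∀ i, Definable v (S i)) →
    (∀ J : Finset ι, ∃ x, ∀ i ∈ J, x ∈ S i) → ∃ x, ∀ i, x ∈ S i

/-! ### Back and forth -/

section BackAndForth

variable {F : Type u} [Field F] {g h : F →+* K}

omit [LinearOrderedAddCommGroupWithTop Γ] in
theorem FieldTerm.exists_realize_eq {A : Set K} (hA : ∀ a ∈ A, ∃ e, g e = a ∧ h e = a) {n : ℕ}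
    (x : Fin n → F) (t : FieldTerm A n) :
    ∃ e, t.realize (g ∘ x) = g e ∧ t.realize (h ∘ x) = h e := by
  induction t with
  | var i => exact ⟨x i, rfl, rfl⟩
  | param a => obtain ⟨e, h1, h2⟩ := hA a a.2; exact ⟨e, h1.symm, h2.symm⟩
  | zero => exact ⟨0, by simp [realize], by simp [realize]⟩
  | one => exact ⟨1, by simp [realize], by simp [realize]⟩
  | neg s ih => obtain ⟨e, h1, h2⟩ := ih; exact ⟨-e, by simp [realize, h1], by simp [realize, h2]⟩
  | add s t ih₁ ih₂ =>
    obtain ⟨e, h1, h2⟩ := ih₁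
    obtain ⟨f, h3, h4⟩ := ih₂
    exact ⟨e + f, by simp [realize, h1, h3], by simp [realize, h2, h4]⟩
  | mul s t ih₁ ih₂ =>
    obtain ⟨e, h1, h2⟩ := ih₁
    obtain ⟨f, h3, h4⟩ := ih₂
    exact ⟨e * f, by simp [realize, h1, h3], by simp [realize, h2, h4]⟩

theorem ValueTerm.exists_realize_eq {A : Set K} {C : Set Γ}
    (hA : ∀ a ∈ A, ∃ e, g e = a ∧ h e = a) (hC : ∀ c ∈ C, ∃ e, v (g e) = c ∧ v (h e) = c)
    {n m : ℕ} (x : Fin n → F) (y : Fin m → F) (t : ValueTerm A C n m) :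
    ∃ e, t.realize v (g ∘ x) (v ∘ g ∘ y) = v (g e) ∧
      t.realize v (h ∘ x) (v ∘ h ∘ y) = v (h e) := by
  induction t with
  | var i => exact ⟨y i, rfl, rfl⟩
  | param c => obtain ⟨e, h1, h2⟩ := hC c c.2; exact ⟨e, h1.symm, h2.symm⟩
  | val t =>
    obtain ⟨e, h1, h2⟩ := t.exists_realize_eq hA x
    exact ⟨e, by simp [realize, h1], by simp [realize, h2]⟩
  | infty => exact ⟨0, by simp [realize], by simp [realize]⟩
  | zero => exact ⟨1, by simp [realize], by simp [realize]⟩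
  | neg s ih =>
    obtain ⟨e, h1, h2⟩ := ih
    -- For `e = 0` this agrees with `-⊤ = ⊤`, since `0⁻¹ = 0`.
    exact ⟨e⁻¹, by simp [realize, h1, v.map_inv], by simp [realize, h2, v.map_inv]⟩
  | add s t ih₁ ih₂ =>
    obtain ⟨e, h1, h2⟩ := ih₁
    obtain ⟨f, h3, h4⟩ := ih₂
    exact ⟨e * f, by simp [realize, h1, h3, v.map_mul], by simp [realize, h2, h4, v.map_mul]⟩

theorem countable_algebraicClosure (F : Type u) [Field F] [Countable F] :
    Countable (AlgebraicClosure F) :=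
  Cardinal.mk_le_aleph0_iff.1 ((Algebra.IsAlgebraic.cardinalMk_le_max F (AlgebraicClosure F)).trans
    (max_le Cardinal.mk_le_aleph0 le_rfl))

/-- In a saturated valued field, every pair of embeddings with equivalent valuations extends to
any further element. -/
theorem SameValues.exists_extension [IsAlgClosed K] (hv : ∃ x : K, x ≠ 0 ∧ v x ≠ 0)
    (hsat : CountablySaturated v) [Countable F] (H : SameValues v g h) (a : K) :
    ∃ (L : Type u) (_ : Field L) (_ : Countable L) (i : F →+* L) (g' h' : L →+* K) (e : L),
      g'.comp i = g ∧ h'.comp i = h ∧ SameValues v g' h' ∧ g' e = a := by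
  obtain ⟨g₁, h₁, hg₁, hh₁, H₁⟩ := H.exists_algebraicClosure
  have := countable_algebraicClosure F
  -- The pattern of `a` over the countable algebraic closure is a countable set of definable
  -- conditions on `b`, finitely satisfiable by `exists_finite_pattern`.
  obtain ⟨b, hb⟩ := hsat (AlgebraicClosure F × AlgebraicClosure F)
    (fun p ↦ {b | v (a - g₁ p.1) ≤ v (g₁ p.2) ↔ b ∈ {b | v (b - h₁ p.1) ≤ v (h₁ p.2)}} ∩
      {b | v (g₁ p.2) ≤ v (a - g₁ p.1) ↔ b ∈ {b | v (h₁ p.2) ≤ v (b - h₁ p.1)}})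
    (fun p ↦ ((definable_val_sub_le v _ _).iff_const _).inter
      ((definable_le_val_sub v _ _).iff_const _))
    (fun J ↦ by
      classical
      obtain ⟨b, hb⟩ := H₁.exists_finite_pattern hv a (J.image Prod.fst) (J.image Prod.snd)
      exact ⟨b, fun p hp ↦ hb p.1 (Finset.mem_image_of_mem _ hp) p.2
        (Finset.mem_image_of_mem _ hp)⟩)
  have hp : SamePattern v g₁ h₁ a b := fun c d ↦ hb (c, d)
  obtain ⟨L, _, _, i, g', h', e, hg', hh', H', he, -⟩ := hp.exists_extension H₁
  exact ⟨L, inferInstance, inferInstance, i.comp (algebraMap F _), g', h', e,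
    by rw [← RingHom.comp_assoc, hg', hg₁], by rw [← RingHom.comp_assoc, hh', hh₁], H', he⟩

/-- Pairs of embeddings with equivalent valuations preserve the truth of formulas. -/
theorem VFormula.realize_iff [IsAlgClosed K] (hsurj : Function.Surjective v)
    (hv : ∃ x : K, x ≠ 0 ∧ v x ≠ 0) (hsat : CountablySaturated v) {A : Set K} {C : Set Γ}
    {n m : ℕ} (φ : VFormula A C n m) :
    ∀ {F : Type u} [Field F] [Countable F] {g h : F →+* K}, SameValues v g h →
      (∀ a ∈ A, ∃ e, g e = a ∧ h e = a) → (∀ c ∈ C, ∃ e, v (g e) = c ∧ v (h e) = c) →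
      ∀ (x : Fin n → F) (y : Fin m → F),
        φ.Realize v (g ∘ x) (v ∘ g ∘ y) ↔ φ.Realize v (h ∘ x) (v ∘ h ∘ y) := by
  have cons_comp : ∀ {L M : Type u} (f : L → M) (e : L) {k : ℕ} (x : Fin k → L),
      f ∘ (Fin.cons e x : Fin (k + 1) → L) = Fin.cons (f e) (f ∘ x) := by
    intro L M f e k x
    funext i
    refine Fin.cases ?_ (fun j ↦ ?_) i <;> simp
  induction φ with
  | eqField s t =>
    intro F _ _ g h H hA hC x y
    obtain ⟨e, h1, h2⟩ := s.exists_realize_eq hA x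
    obtain ⟨f, h3, h4⟩ := t.exists_realize_eq hA x
    simp only [Realize, h1, h2, h3, h4, g.injective.eq_iff, h.injective.eq_iff]
  | eqValue s t =>
    intro F _ _ g h H hA hC x y
    obtain ⟨e, h1, h2⟩ := s.exists_realize_eq hA hC x y
    obtain ⟨f, h3, h4⟩ := t.exists_realize_eq hA hC x y
    simp only [Realize, h1, h2, h3, h4, H.eq_iff]
  | leValue s t =>
    intro F _ _ g h H hA hC x y
    obtain ⟨e, h1, h2⟩ := s.exists_realize_eq hA hC x y
    obtain ⟨f, h3, h4⟩ := t.exists_realize_eq hA hC x y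
    simp only [Realize, h1, h2, h3, h4]
    exact H e f
  | not φ ih =>
    intro F _ _ g h H hA hC x y
    exact not_congr (ih H hA hC x y)
  | and φ ψ ih₁ ih₂ =>
    intro F _ _ g h H hA hC x y
    exact and_congr (ih₁ H hA hC x y) (ih₂ H hA hC x y)
  | exField φ ih =>
    -- One direction suffices, the hypotheses being symmetric in `g` and `h`. A witness `a` becomes
    -- `g' e` over a larger field, and `h' e` is the witness on the other side.
    have dir : ∀ {F : Type u} [Field F] [Countable F] {g h : F →+* K}, SameValues v g h →
        (∀ a ∈ A, ∃ e, g e = a ∧ h e = a) → (∀ c ∈ C, ∃ e, v (g e) = c ∧ v (h e) = c) →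
        ∀ x y, (VFormula.exField φ).Realize v (g ∘ x) (v ∘ g ∘ y) →
          (VFormula.exField φ).Realize v (h ∘ x) (v ∘ h ∘ y) := by
      rintro F _ _ g h H hA hC x y ⟨a, ha⟩
      obtain ⟨L, _, _, i, g', h', e, rfl, rfl, H', rfl⟩ := H.exists_extension hv hsat a
      refine ⟨h' e, ?_⟩
      have key := ih H' (fun a ha ↦ let ⟨e, he⟩ := hA a ha; ⟨i e, he⟩)
        (fun c hc ↦ let ⟨e, he⟩ := hC c hc; ⟨i e, he⟩) (Fin.cons e (i ∘ x)) (i ∘ y)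
      rw [cons_comp, cons_comp] at key
      exact key.1 ha
    intro F _ _ g h H hA hC x y
    exact ⟨dir H hA hC x y, dir H.symm (fun a ha ↦ let ⟨e, he⟩ := hA a ha; ⟨e, he.symm⟩)
      (fun c hc ↦ let ⟨e, he⟩ := hC c hc; ⟨e, he.symm⟩) x y⟩
  | exValue φ ih =>
    have dir : ∀ {F : Type u} [Field F] [Countable F] {g h : F →+* K}, SameValues v g h →
        (∀ a ∈ A, ∃ e, g e = a ∧ h e = a) → (∀ c ∈ C, ∃ e, v (g e) = c ∧ v (h e) = c) →
        ∀ x y, (VFormula.exValue φ).Realize v (g ∘ x) (v ∘ g ∘ y) →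
          (VFormula.exValue φ).Realize v (h ∘ x) (v ∘ h ∘ y) := by
      rintro F _ _ g h H hA hC x y ⟨c, hc⟩
      -- Surjectivity of `v` reduces a quantifier over values to an extension by a field element.
      obtain ⟨a, rfl⟩ := hsurj c
      obtain ⟨L, _, _, i, g', h', e, rfl, rfl, H', rfl⟩ := H.exists_extension hv hsat a
      refine ⟨v (h' e), ?_⟩
      have key := ih H' (fun a ha ↦ let ⟨e, he⟩ := hA a ha; ⟨i e, he⟩)
        (fun c hc ↦ let ⟨e, he⟩ := hC c hc; ⟨i e, he⟩) (i ∘ x) (Fin.cons e (i ∘ y))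
      rw [cons_comp, cons_comp, cons_comp, cons_comp] at key
      exact key.1 hc
    intro F _ _ g h H hA hC x y
    exact ⟨dir H hA hC x y, dir H.symm (fun a ha ↦ let ⟨e, he⟩ := hA a ha; ⟨e, he.symm⟩)
      (fun c hc ↦ let ⟨e, he⟩ := hC c hc; ⟨e, he.symm⟩) x y⟩

/-- A definable set is determined by the pattern over a countable algebraically closed field. -/
theorem Definable.exists_countable_pattern [IsAlgClosed K] (hsurj : Function.Surjective v)
    (hv : ∃ x : K, x ≠ 0 ∧ v x ≠ 0) (hsat : CountablySaturated v) {X : Set K}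
    (hX : Definable v X) :
    ∃ (F : Type u) (_ : Field F) (_ : Countable F) (g : F →+* K),
      ∀ a b, SamePattern v g g a b → (a ∈ X ↔ b ∈ X) := by
  obtain ⟨φ, hφ⟩ := (definable_iff v X).1 hX
  obtain ⟨A₀, C₀, hA₀, hC₀, hψ⟩ := φ.exists_finite_params v
  obtain ⟨ψ, hψ⟩ := hψ A₀ C₀ le_rfl le_rfl
  -- Value parameters are replaced by field elements having those values.
  let B : Set K := A₀ ∪ Function.surjInv hsurj '' C₀
  have hB : B.Finite := hA₀.union (hC₀.image _)
  let E := Subfield.closure B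
  have hE : Countable E := by
    have := hB.countable.to_subtype
    refine Cardinal.mk_le_aleph0_iff.1 ((Subfield.cardinalMk_closure_le_max B).trans ?_)
    exact max_le Cardinal.mk_le_aleph0 le_rfl
  have hEE : SameValues v E.subtype E.subtype := fun _ _ ↦ Iff.rfl
  have := countable_algebraicClosure E
  obtain ⟨g, -, hg, -, -⟩ := hEE.exists_algebraicClosure
  have hBg : ∀ b ∈ B, ∃ e, g e = b := fun b hb ↦
    ⟨algebraMap E _ ⟨b, Subfield.subset_closure hb⟩, RingHom.congr_fun hg ⟨b, _⟩⟩
  refine ⟨AlgebraicClosure E, inferInstance, inferInstance, g, fun a b hab ↦ ?_⟩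
  -- Equal patterns extend the pair `(g, g)` so that one element `e` is sent to `a` and to `b`;
  -- formulas over `B` then cannot separate them.
  obtain ⟨L, _, _, i, g', h', e, hg', hh', H', rfl, rfl⟩ :=
    hab.exists_extension (fun _ _ ↦ Iff.rfl)
  have key := ψ.realize_iff hsurj hv hsat H'
    (fun a ha ↦ by
      obtain ⟨e, he⟩ := hBg a (Or.inl ha)
      exact ⟨i e, by rw [← he, ← hg']; rfl, by rw [← he, ← hh']; rfl⟩)
    (fun c hc ↦ by
      obtain ⟨e, he⟩ := hBg _ (Or.inr ⟨c, hc, rfl⟩)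
      have hc' : v (g e) = c := by rw [he]; exact Function.surjInv_eq hsurj c
      exact ⟨i e, by rw [← hc', ← hg']; rfl, by rw [← hc', ← hh']; rfl⟩)
    (fun _ ↦ e) (fun _ ↦ e)
  rw [hψ, hψ, hφ, hφ] at key
  exact key

end BackAndForth

end Formulas

/-! ### Balls, Swiss cheeses and width. -/

section Balls

variable {K Γ : Type u} [Field K] [LinearOrderedAddCommGroupWithTop Γ] (v : AddValuation K Γ)

/-- The closed ball around `0` as a subgroup. -/
def closedBallSubgroup (r : Γ) : AddSubgroup K where
  carrier := closedBall v r
  zero_mem' := by simp [closedBall]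
  add_mem' ha hb := v.map_le_add ha hb
  neg_mem' ha := by
    change r ≤ v _
    rw [v.map_neg]
    exact ha

/-- The open ball of finite radius around `0` as a subgroup. -/
def openBallSubgroup (r : Γ) (hr : r ≠ ⊤) : AddSubgroup K where
  carrier := openBall v r
  zero_mem' := by simpa [openBall, lt_top_iff_ne_top] using hr
  add_mem' ha hb := v.map_lt_add ha hb
  neg_mem' ha := by
    change r < v _
    rw [v.map_neg]
    exact ha

/-- The subgroups that are balls around `0`, including `{0}` and the whole field. -/
def IsBall (W : AddSubgroup K) : Prop :=
  (∃ r, (W : Set K) = closedBall v r) ∨ (∃ r, (W : Set K) = openBall v r) ∨ W = ⊤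

variable {v}

theorem isBall_closedBallSubgroup (r : Γ) : IsBall v (closedBallSubgroup v r) := Or.inl ⟨r, rfl⟩

theorem isBall_openBallSubgroup (r : Γ) (hr : r ≠ ⊤) : IsBall v (openBallSubgroup v r hr) :=
  Or.inr (Or.inl ⟨r, rfl⟩)

theorem IsBall.mem_of_le {W : AddSubgroup K} (hW : IsBall v W) {x y : K} (hx : x ∈ W)
    (hxy : v x ≤ v y) : y ∈ W := by
  rcases hW with ⟨r, hr⟩ | ⟨r, hr⟩ | rfl
  · rw [← SetLike.mem_coe, hr] at hx ⊢
    exact le_trans hx hxy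
  · rw [← SetLike.mem_coe, hr] at hx ⊢
    exact lt_of_lt_of_le hx hxy
  · trivial

/-- Membership in a ball around `0` depends only on the value and is upward closed in it. -/
theorem IsBall.le_total {W V : AddSubgroup K} (hW : IsBall v W) (hV : IsBall v V) :
    W ≤ V ∨ V ≤ W := by
  by_contra hcon
  push Not at hcon
  obtain ⟨x, hxW, hxV⟩ := SetLike.not_le_iff_exists.1 hcon.1
  obtain ⟨y, hyV, hyW⟩ := SetLike.not_le_iff_exists.1 hcon.2
  rcases _root_.le_total (v x) (v y) with h | h
  · exact hyW (hW.mem_of_le hxW h)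
  · exact hxV (hV.mem_of_le hyV h)

theorem IsBall.definable_coset {W : AddSubgroup K} (hW : IsBall v W) (c : K) :
    Definable v {x | x - c ∈ W} := by
  rcases hW with ⟨r, hr⟩ | ⟨r, hr⟩ | rfl
  · have : {x | x - c ∈ W} = {x | r ≤ v (x - c)} := by
      ext x
      rw [Set.mem_ofPred_eq, ← SetLike.mem_coe, hr]
      rfl
    rw [this]
    exact definable_le_val_sub v c r
  · have : {x | x - c ∈ W} = {x | v (x - c) ≤ r}ᶜ := by
      ext x
      rw [Set.mem_ofPred_eq, ← SetLike.mem_coe, hr, Set.mem_compl_iff, Set.mem_ofPred_eq, not_le]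
      rfl
    rw [this]
    exact (definable_val_sub_le v c r).compl
  · simpa using definable_univ v

/-- Balls around `0` form a chain, so a finite intersection is its smallest member, or `K` if no
ball is selected. -/
theorem exists_isBall_iInf {ι : Type*} (J : Finset ι) (V : ι → AddSubgroup K)
    (hV : ∀ i, IsBall v (V i)) (p : ι → Prop) :
    ∃ W, IsBall v W ∧ ∀ x, x ∈ W ↔ ∀ i ∈ J, p i → x ∈ V i := by
  classical
  induction J using Finset.induction with
  | empty => exact ⟨⊤, Or.inr (Or.inr rfl), by simp⟩
  | insert j J hj ih =>
    obtain ⟨W, hW, hWx⟩ := ih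
    by_cases hp : p j
    · rcases hW.le_total (hV j) with h | h
      · refine ⟨W, hW, fun x ↦ ?_⟩
        rw [Finset.forall_mem_insert, ← hWx]
        exact ⟨fun hx ↦ ⟨fun _ ↦ h hx, hx⟩, fun hx ↦ hx.2⟩
      · refine ⟨V j, hV j, fun x ↦ ?_⟩
        rw [Finset.forall_mem_insert, ← hWx]
        exact ⟨fun hx ↦ ⟨fun _ ↦ hx, h hx⟩, fun hx ↦ hx.1 hp⟩
    · refine ⟨W, hW, fun x ↦ ?_⟩
      rw [Finset.forall_mem_insert, ← hWx]
      exact ⟨fun hx ↦ ⟨fun h ↦ absurd h hp, hx⟩, fun hx ↦ hx.2⟩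

variable (v) in
/-- `X` is covered by finitely many cosets of a ball all of whose elements are differences of
elements of `X`. -/
def HasWidth (X : Set K) : Prop :=
  ∃ W, IsBall v W ∧ (∃ T : Finset K, ∀ x ∈ X, ∃ t ∈ T, x - t ∈ W) ∧ ∀ w ∈ W, ∃ x ∈ X, x + w ∈ X

/-- The larger of the two balls works: it absorbs the cosets of the smaller one, and its own set
already supplies the differences. -/
theorem HasWidth.union {X Y : Set K} (hX : HasWidth v X) (hY : HasWidth v Y) :
    HasWidth v (X ∪ Y) := by
  classical
  obtain ⟨W, hW, ⟨T, hT⟩, hWX⟩ := hX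
  obtain ⟨V, hV, ⟨S, hS⟩, hVY⟩ := hY
  rcases hW.le_total hV with h | h
  · refine ⟨V, hV, ⟨T ∪ S, ?_⟩, fun w hw ↦ ?_⟩
    · rintro x (hx | hx)
      · obtain ⟨t, ht, hxt⟩ := hT x hx
        exact ⟨t, Finset.mem_union_left _ ht, h hxt⟩
      · obtain ⟨t, ht, hxt⟩ := hS x hx
        exact ⟨t, Finset.mem_union_right _ ht, hxt⟩
    · obtain ⟨x, hx, hxw⟩ := hVY w hw
      exact ⟨x, Or.inr hx, Or.inr hxw⟩
  · refine ⟨W, hW, ⟨T ∪ S, ?_⟩, fun w hw ↦ ?_⟩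
    · rintro x (hx | hx)
      · obtain ⟨t, ht, hxt⟩ := hT x hx
        exact ⟨t, Finset.mem_union_left _ ht, hxt⟩
      · obtain ⟨t, ht, hxt⟩ := hS x hx
        exact ⟨t, Finset.mem_union_right _ ht, h hxt⟩
    · obtain ⟨x, hx, hxw⟩ := hWX w hw
      exact ⟨x, Or.inl hx, Or.inl hxw⟩

theorem hasWidth_biUnion {ι : Type*} (J : Finset ι) (S : ι → Set K)
    (hS : ∀ i ∈ J, S i = ∅ ∨ HasWidth v (S i)) :
    (⋃ i ∈ J, S i) = ∅ ∨ HasWidth v (⋃ i ∈ J, S i) := by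
  classical
  induction J using Finset.induction with
  | empty => simp
  | insert j J hj ih =>
    rw [Finset.set_biUnion_insert]
    rcases hS j (Finset.mem_insert_self _ _) with h1 | h1 <;>
      rcases ih fun i hi ↦ hS i (Finset.mem_insert_of_mem hi) with h2 | h2
    · left; rw [h1, h2, Set.union_empty]
    · right; rwa [h1, Set.empty_union]
    · right; rwa [h2, Set.union_empty]
    · right; exact h1.union h2

/-- A finite Boolean combination of balls has a width (Swiss cheese). -/
theorem hasWidth_cell [IsAlgClosed K] {ι : Type*} (J : Finset ι) (c : ι → K)
    (V : ι → AddSubgroup K) (hV : ∀ i, IsBall v (V i)) (a : K) :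
    HasWidth v {x | ∀ i ∈ J, x - c i ∈ V i ↔ a - c i ∈ V i} := by
  classical
  -- The balls containing `a` intersect in `a + W`.
  obtain ⟨W, hW, hWx⟩ := exists_isBall_iInf J V hV fun i ↦ a - c i ∈ V i
  have hWV : ∀ i ∈ J, a - c i ∈ V i → W ≤ V i := fun i hi hai x hx ↦ (hWx x).1 hx i hi hai
  refine ⟨W, hW, ⟨{a}, fun x hx ↦ ⟨a, Finset.mem_singleton_self a, ?_⟩⟩, fun w hw ↦ ?_⟩
  · refine (hWx _).2 fun i hi hai ↦ ?_
    simpa using sub_mem ((hx i hi).2 hai) hai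
  -- Only holes not containing a whole translate of `W` matter: if `W ≤ V i` and `a` misses the
  -- hole, so does all of `a + W`.
  let N := J.filter fun i ↦ a - c i ∉ V i ∧ ¬ W ≤ V i
  have crit : ∀ x, x - a ∈ W → (∀ i ∈ N, x - c i ∉ V i) →
      x ∈ {x | ∀ i ∈ J, x - c i ∈ V i ↔ a - c i ∈ V i} := by
    intro x hxa hxN i hi
    have hsplit : x - c i = (x - a) + (a - c i) := by ring
    by_cases hai : a - c i ∈ V i
    · refine iff_of_true ?_ hai
      rw [hsplit]
      exact add_mem (hWV i hi hai hxa) hai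
    · refine iff_of_false (fun hxi ↦ ?_) hai
      by_cases hle : W ≤ V i
      · refine hai ?_
        rw [hsplit] at hxi
        simpa using sub_mem hxi (hle hxa)
      · exact hxN i (Finset.mem_filter.2 ⟨hi, hai, hle⟩) hxi
  rcases N.eq_empty_or_nonempty with hN | hN
  · exact ⟨a, crit a (by simp) (by simp [hN]), crit _ (by simpa using hw) (by simp [hN])⟩
  have hy : ∀ i : N, ∃ y ∈ W, y ∉ V i := fun i ↦
    SetLike.not_le_iff_exists.1 (Finset.mem_filter.1 i.2).2.2
  choose y hyW hyV using hy
  -- Among elements of `W` witnessing that the holes are smaller, `y j` has the least value; nothing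
  -- of value at most `v (y j)` lies in any `V i` with `i ∈ N`.
  obtain ⟨j, -, hj⟩ := N.attach.exists_min_image (fun i ↦ v (y i)) (by simpa using hN)
  have hyj : ∀ i ∈ N, ∀ z, v z ≤ v (y j) → z ∉ V i := fun i hi z hz hzV ↦
    hyV ⟨i, hi⟩ ((hV i).mem_of_le hzV (hz.trans (hj ⟨i, hi⟩ (Finset.mem_attach _ _))))
  have hy0 : y j ≠ 0 := fun h0 ↦ hyV j (h0 ▸ zero_mem _)
  -- Avoiding the centres `c i` and their translates `c i - w` keeps both `x` and `x + w` out of the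
  -- holes.
  obtain ⟨x, hxa, hxU⟩ := exists_val_sub_le v (N.image c ∪ N.image fun i ↦ c i - w) a hy0
  have hxaW : x - a ∈ W := hW.mem_of_le (hyW j) hxa
  refine ⟨x, crit x hxaW fun i hi ↦ hyj i hi _ (hxU _ ?_), crit (x + w) ?_ fun i hi ↦ ?_⟩
  · exact Finset.mem_union_left _ (Finset.mem_image_of_mem _ hi)
  · rw [add_sub_right_comm]
    exact add_mem hxaW hw
  · have := hyj i hi _ (hxU (c i - w) (Finset.mem_union_right _ (Finset.mem_image_of_mem _ hi)))
    rwa [sub_sub_eq_add_sub] at this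

/-- The pattern over a countable field amounts to membership in countably many balls. One use of
saturation encloses each point of `X` in a cell contained in `X` and cut out by finitely many balls;
a second one covers `X` by finitely many such cells. -/
theorem Definable.hasWidth_of_countablySaturated [IsAlgClosed K] (hsurj : Function.Surjective v)
    (hv : ∃ x : K, x ≠ 0 ∧ v x ≠ 0) (hsat : CountablySaturated v) {X : Set K}
    (hX : Definable v X) (hne : X.Nonempty) : HasWidth v X := by
  classical
  obtain ⟨F, _, _, g, hF⟩ := hX.exists_countable_pattern hsurj hv hsat
  let ι := F × F × Bool
  let c : ι → K := fun i ↦ g i.1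
  -- The flag selects open or closed balls. For radius `⊤` the open ball is empty and not a
  -- subgroup, so the closed one stands in.
  let V : ι → AddSubgroup K := fun i ↦
    if h : i.2.2 = true ∧ v (g i.2.1) ≠ ⊤ then openBallSubgroup v (v (g i.2.1)) h.2
    else closedBallSubgroup v (v (g i.2.1))
  have hV : ∀ i, IsBall v (V i) := by
    intro i
    by_cases h : i.2.2 = true ∧ v (g i.2.1) ≠ ⊤
    · simp only [V, dif_pos h]
      exact isBall_openBallSubgroup _ _
    · simp only [V, dif_neg h]
      exact isBall_closedBallSubgroup _
  have hpat : ∀ a b, (∀ i, b - c i ∈ V i ↔ a - c i ∈ V i) → SamePattern v g g a b := by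
    intro a b hab e d
    constructor
    · by_cases hd : v (g d) = ⊤
      · simp [hd]
      · have := hab (e, d, true)
        simp only [V, c, ne_eq, hd, not_false_eq_true, and_self, dite_true] at this
        change (v (g d) < v (b - g e) ↔ v (g d) < v (a - g e)) at this
        rw [← not_lt, ← not_lt, this]
    · have := hab (e, d, false)
      simp only [V, c, Bool.false_eq_true, false_and, dite_false] at this
      change (v (g d) ≤ v (b - g e) ↔ v (g d) ≤ v (a - g e)) at this
      exact this.symm
  have hdef : ∀ i, Definable v {x | x - c i ∈ V i} := fun i ↦ (hV i).definable_coset _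
  have step : ∀ a ∈ X, ∃ J : Finset ι, {x | ∀ i ∈ J, x - c i ∈ V i ↔ a - c i ∈ V i} ⊆ X := by
    intro a ha
    by_contra hcon
    push Not at hcon
    obtain ⟨x, hx⟩ := hsat (Option ι)
      -- The index `none` demands a point outside `X`, and the others demand the pattern of `a`; no
      -- point satisfies both.
      (fun o ↦ o.elim Xᶜ fun i ↦ {x | a - c i ∈ V i ↔ x ∈ {x | x - c i ∈ V i}}) (by
        rintro (_ | i)
        · exact hX.compl
        · exact (hdef i).iff_const _) (by
        intro J
        obtain ⟨x, hx, hxX⟩ := Set.not_subset.1 (hcon J.eraseNone)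
        refine ⟨x, ?_⟩
        rintro (_ | i) hi
        · exact hxX
        · exact (hx i (Finset.mem_eraseNone.2 hi)).symm)
    exact hx none ((hF a x (hpat a x fun i ↦ (hx (some i)).symm)).1 ha)
  let cell : Finset ι × Finset ι → Set K := fun p ↦ {x | ∀ i ∈ p.1, x - c i ∈ V i ↔ i ∈ p.2}
  have hcell : ∀ p, cell p = ∅ ∨ HasWidth v (cell p) := by
    intro p
    rcases (cell p).eq_empty_or_nonempty with h | ⟨a, ha⟩
    · exact Or.inl h
    · right
      have : cell p = {x | ∀ i ∈ p.1, x - c i ∈ V i ↔ a - c i ∈ V i} := by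
        ext x
        exact forall₂_congr fun i hi ↦ by rw [ha i hi]
      rw [this]
      exact hasWidth_cell p.1 c V hV a
  have hcelldef : ∀ p, Definable v (cell p) := by
    intro p
    have : cell p = ⋂ i ∈ p.1, {x | i ∈ p.2 ↔ x ∈ {x | x - c i ∈ V i}} := by
      ext x
      simp only [cell, Set.mem_ofPred_eq, Set.mem_iInter]
      exact forall₂_congr fun i hi ↦ Iff.comm
    rw [this]
    exact definable_biInter _ fun i _ ↦ (hdef i).iff_const _
  -- There are only countably many cells, so if no finite number of those inside `X` covered `X`, a
  -- point of `X` would avoid them all.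
  obtain ⟨P, hP⟩ : ∃ P : Finset {p // cell p ⊆ X}, X ⊆ ⋃ p ∈ P, cell p := by
    by_contra hcon
    push Not at hcon
    obtain ⟨x, hx⟩ := hsat (Option {p // cell p ⊆ X}) (fun o ↦ o.elim X fun p ↦ (cell p)ᶜ) (by
        rintro (_ | p)
        · exact hX
        · exact (hcelldef p).compl) (by
        intro J
        obtain ⟨x, hx, hxX⟩ := Set.not_subset.1 (hcon J.eraseNone)
        refine ⟨x, ?_⟩
        rintro (_ | p) hp
        · exact hx
        · exact fun hxp ↦ hxX (Set.mem_biUnion (Finset.mem_eraseNone.2 hp) hxp))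
    obtain ⟨J, hJ⟩ := step x (hx none)
    let s := J.filter fun i ↦ x - c i ∈ V i
    have hs : ∀ i ∈ J, (i ∈ s ↔ x - c i ∈ V i) := fun i hi ↦ by simp [s, hi]
    refine hx (some ⟨(J, s), fun y hy ↦ hJ fun i hi ↦ ?_⟩) fun i hi ↦ (hs i hi).symm
    rw [hy i hi, hs i hi]
  have heq : X = ⋃ p ∈ P, cell p := hP.antisymm (Set.iUnion₂_subset fun p _ ↦ p.2)
  have := hasWidth_biUnion (v := v) P (fun p ↦ cell p) fun p _ ↦ hcell p
  rw [← heq] at this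
  exact this.resolve_left hne.ne_empty

end Balls

open Filter

/-! ### Ultrapowers and removal of the saturation hypothesis. -/

section Ultrapower

/-- The ultrapower of a type over the natural numbers. -/
abbrev Ultrapower (α : Type u) : Type u := (hyperfilter ℕ : Filter ℕ).Germ α

theorem exists_forall_eventually {α : Type u} [Nonempty α] {p : ℕ → α → Prop}
    (h : ∀ᶠ k in (hyperfilter ℕ : Filter ℕ), ∃ a, p k a) :
    ∃ f : ℕ → α, ∀ᶠ k in (hyperfilter ℕ : Filter ℕ), p k (f k) :=
  ⟨fun k ↦ Classical.epsilon (p k), h.mono fun _ hk ↦ Classical.epsilon_spec hk⟩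

theorem exists_rep {α : Type u} {ι : Type*} (x : ι → Ultrapower α) :
    ∃ f : ι → ℕ → α, x = fun i ↦ (f i : Ultrapower α) := by
  have : ∀ i, ∃ f : ℕ → α, (f : Ultrapower α) = x i := fun i ↦
    (x i).inductionOn fun f ↦ ⟨f, rfl⟩
  choose f hf using this
  exact ⟨f, funext fun i ↦ (hf i).symm⟩

noncomputable instance {Γ : Type u} [LinearOrderedAddCommGroupWithTop Γ] :
    LinearOrderedAddCommGroupWithTop (Ultrapower Γ) where
  top_add' x := x.inductionOn fun f ↦ congrArg Germ.ofFun (funext fun k ↦ top_add (f k))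
  neg_top := congrArg Germ.ofFun
    (funext fun _ ↦ LinearOrderedAddCommGroupWithTop.neg_top : (fun _ : ℕ ↦ -(⊤ : Γ)) = fun _ ↦ ⊤)
  add_neg_cancel_of_ne_top x := by
    refine x.inductionOn fun f hf ↦ Germ.coe_eq.2 ?_
    have hf' : ∀ᶠ k in (hyperfilter ℕ : Filter ℕ), f k ≠ ⊤ :=
      Ultrafilter.eventually_not.2 fun h ↦ hf (Germ.coe_eq.2 h)
    exact hf'.mono fun k hk ↦ LinearOrderedAddCommGroupWithTop.add_neg_cancel_of_ne_top hk

variable {K Γ : Type u} [Field K] [LinearOrderedAddCommGroupWithTop Γ] (v : AddValuation K Γ)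

/-- The valuation of the ultrapower. -/
noncomputable def ultraVal : AddValuation (Ultrapower K) (Ultrapower Γ) :=
  AddValuation.of (Germ.map v)
    (congrArg Germ.ofFun (funext fun _ ↦ v.map_zero : (fun _ : ℕ ↦ v 0) = fun _ ↦ ⊤))
    (congrArg Germ.ofFun (funext fun _ ↦ v.map_one : (fun _ : ℕ ↦ v 1) = fun _ ↦ 0))
    (fun x y ↦ Germ.inductionOn₂ x y fun f g ↦ by
      have h : ∀ k, v (f k) ≤ v (f k + g k) ∨ v (g k) ≤ v (f k + g k) := fun k ↦ v.map_add' _ _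
      rw [min_le_iff]
      exact (Ultrafilter.eventually_or.1 (Eventually.of_forall h)).imp id id)
    (fun x y ↦ Germ.inductionOn₂ x y fun f g ↦
      congrArg Germ.ofFun (funext fun k ↦ v.map_mul (f k) (g k)))

variable {v}

theorem ultraVal_surjective (hsurj : Function.Surjective v) :
    Function.Surjective (ultraVal v) := fun c ↦
  c.inductionOn fun f ↦ ⟨((fun k ↦ Function.surjInv hsurj (f k) : ℕ → K) : Ultrapower K),
    congrArg Germ.ofFun (funext fun k ↦ Function.surjInv_eq hsurj (f k))⟩

theorem ultraVal_nontrivial (hv : ∃ x : K, x ≠ 0 ∧ v x ≠ 0) :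
    ∃ x : Ultrapower K, x ≠ 0 ∧ ultraVal v x ≠ 0 := by
  obtain ⟨x, hx, hvx⟩ := hv
  exact ⟨((fun _ ↦ x : ℕ → K) : Ultrapower K),
    fun h ↦ hx (by simpa using (Germ.coe_eq.1 h).exists.choose_spec),
    fun h ↦ hvx (by simpa using (Germ.coe_eq.1 h).exists.choose_spec)⟩

/-- A monic polynomial over the ultrapower is represented by monic polynomials over `K` of the same
degree; roots chosen in each coordinate form a root. -/
instance [IsAlgClosed K] : IsAlgClosed (Ultrapower K) := by
  refine IsAlgClosed.of_exists_root _ fun p hp hirr ↦ ?_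
  obtain ⟨c, hc⟩ := exists_rep p.coeff
  have hdeg : p.natDegree ≠ 0 := hirr.natDegree_pos.ne'
  have hroot : ∀ k, ∃ x : K, x ^ p.natDegree +
      ∑ i ∈ Finset.range p.natDegree, c i k * x ^ i = 0 := by
    intro k
    let q : Polynomial K := Polynomial.X ^ p.natDegree +
      ∑ i ∈ Finset.range p.natDegree, Polynomial.C (c i k) * Polynomial.X ^ i
    have hq : q.degree = p.natDegree := by
      rw [← Polynomial.degree_X_pow (R := K) p.natDegree]
      refine Polynomial.degree_add_eq_left_of_degree_lt ?_
      rw [Polynomial.degree_X_pow]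
      refine ((Polynomial.degree_sum_le _ _).trans_lt ?_)
      refine (Finset.sup_lt_iff (WithBot.bot_lt_coe _)).2 fun i hi ↦ ?_
      exact (Polynomial.degree_C_mul_X_pow_le _ _).trans_lt
        (by exact_mod_cast Finset.mem_range.1 hi)
    obtain ⟨x, hx⟩ := IsAlgClosed.exists_root q (by rw [hq]; exact_mod_cast hdeg)
    refine ⟨x, ?_⟩
    simpa [q, Polynomial.IsRoot, Polynomial.eval_finsetSum] using hx
  choose x hx using hroot
  refine ⟨(x : Ultrapower K), ?_⟩
  rw [Polynomial.eval_eq_sum_range, Finset.sum_range_succ, hp.coeff_natDegree, one_mul, add_comm]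
  have h1 : ∀ i, p.coeff i * (x : Ultrapower K) ^ i = Germ.coeRingHom _ (c i * x ^ i) := by
    intro i
    rw [hc]
    rfl
  rw [Finset.sum_congr rfl fun i _ ↦ h1 i, ← map_sum]
  change Germ.coeRingHom _ (x ^ p.natDegree) + _ = _
  rw [← map_add, ← map_zero (Germ.coeRingHom (R := K) _)]
  congr 1
  funext k
  simpa using hx k

/-! ### Łoś's theorem -/

/-- A subset of the ultrapower given by a sequence of subsets. -/
def Internal {n m : ℕ} (S : Set ((Fin n → Ultrapower K) × (Fin m → Ultrapower Γ)))
    (Φ : ℕ → Set ((Fin n → K) × (Fin m → Γ))) : Prop :=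
  ∀ (x : Fin n → ℕ → K) (y : Fin m → ℕ → Γ),
    ((fun i ↦ (x i : Ultrapower K)), fun j ↦ (y j : Ultrapower Γ)) ∈ S ↔
      ∀ᶠ k in (hyperfilter ℕ : Filter ℕ), ((fun i ↦ x i k), fun j ↦ y j k) ∈ Φ k

section Internal

variable {n m : ℕ}

omit [Field K] [LinearOrderedAddCommGroupWithTop Γ] in
theorem Internal.compl {S : Set ((Fin n → Ultrapower K) × (Fin m → Ultrapower Γ))}
    {Φ : ℕ → Set ((Fin n → K) × (Fin m → Γ))} (h : Internal S Φ) :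
    Internal Sᶜ fun k ↦ (Φ k)ᶜ := fun x y ↦
  (not_congr (h x y)).trans Ultrafilter.eventually_not.symm

omit [Field K] [LinearOrderedAddCommGroupWithTop Γ] in
theorem Internal.inter {S T : Set ((Fin n → Ultrapower K) × (Fin m → Ultrapower Γ))}
    {Φ Ψ : ℕ → Set ((Fin n → K) × (Fin m → Γ))} (h : Internal S Φ) (h' : Internal T Ψ) :
    Internal (S ∩ T) fun k ↦ Φ k ∩ Ψ k := fun x y ↦
  (and_congr (h x y) (h' x y)).trans eventually_and.symm

-- Existential step of Łoś's theorem: witnesses in almost all coordinates assemble into one germ.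
omit [LinearOrderedAddCommGroupWithTop Γ] in
theorem Internal.exField {S : Set ((Fin (n + 1) → Ultrapower K) × (Fin m → Ultrapower Γ))}
    {Φ : ℕ → Set ((Fin (n + 1) → K) × (Fin m → Γ))} (h : Internal S Φ) :
    Internal {p | ∃ a, ((Fin.cons a p.1 : Fin (n + 1) → Ultrapower K), p.2) ∈ S}
      fun k ↦ {p | ∃ a, ((Fin.cons a p.1 : Fin (n + 1) → K), p.2) ∈ Φ k} := by
  intro x y
  have key : ∀ a : ℕ → K, ((Fin.cons (a : Ultrapower K) fun i ↦ (x i : Ultrapower K) :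
      Fin (n + 1) → Ultrapower K), fun j ↦ (y j : Ultrapower Γ)) ∈ S ↔
      ∀ᶠ k in (hyperfilter ℕ : Filter ℕ),
        ((Fin.cons (a k) fun i ↦ x i k : Fin (n + 1) → K), fun j ↦ y j k) ∈ Φ k := by
    intro a
    have e₁ : (Fin.cons (a : Ultrapower K) fun i ↦ (x i : Ultrapower K) :
        Fin (n + 1) → Ultrapower K) =
        fun i ↦ ((Fin.cons a x : Fin (n + 1) → ℕ → K) i : Ultrapower K) := by
      funext i
      refine Fin.cases ?_ (fun j ↦ ?_) i <;> simp
    have e₂ : ∀ k, (Fin.cons (a k) fun i ↦ x i k : Fin (n + 1) → K) =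
        fun i ↦ (Fin.cons a x : Fin (n + 1) → ℕ → K) i k := by
      intro k
      funext i
      refine Fin.cases ?_ (fun j ↦ ?_) i <;> simp
    rw [e₁]
    simp only [e₂]
    exact h _ y
  constructor
  · rintro ⟨a, ha⟩
    induction a using Germ.inductionOn with
    | h a => exact ((key a).1 ha).mono fun k hk ↦ ⟨a k, hk⟩
  · intro hex
    obtain ⟨a, ha⟩ := exists_forall_eventually hex
    exact ⟨a, (key a).2 ha⟩

omit [Field K] in
theorem Internal.exValue {S : Set ((Fin n → Ultrapower K) × (Fin (m + 1) → Ultrapower Γ))}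
    {Φ : ℕ → Set ((Fin n → K) × (Fin (m + 1) → Γ))} (h : Internal S Φ) :
    Internal {p | ∃ c, (p.1, (Fin.cons c p.2 : Fin (m + 1) → Ultrapower Γ)) ∈ S}
      fun k ↦ {p | ∃ c, (p.1, (Fin.cons c p.2 : Fin (m + 1) → Γ)) ∈ Φ k} := by
  intro x y
  have key : ∀ c : ℕ → Γ, ((fun i ↦ (x i : Ultrapower K)),
      (Fin.cons (c : Ultrapower Γ) fun j ↦ (y j : Ultrapower Γ) :
        Fin (m + 1) → Ultrapower Γ)) ∈ S ↔
      ∀ᶠ k in (hyperfilter ℕ : Filter ℕ),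
        ((fun i ↦ x i k), (Fin.cons (c k) fun j ↦ y j k : Fin (m + 1) → Γ)) ∈ Φ k := by
    intro c
    have e₁ : (Fin.cons (c : Ultrapower Γ) fun j ↦ (y j : Ultrapower Γ) :
        Fin (m + 1) → Ultrapower Γ) =
        fun j ↦ ((Fin.cons c y : Fin (m + 1) → ℕ → Γ) j : Ultrapower Γ) := by
      funext i
      refine Fin.cases ?_ (fun j ↦ ?_) i <;> simp
    have e₂ : ∀ k, (Fin.cons (c k) fun j ↦ y j k : Fin (m + 1) → Γ) =
        fun j ↦ (Fin.cons c y : Fin (m + 1) → ℕ → Γ) j k := by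
      intro k
      funext i
      refine Fin.cases ?_ (fun j ↦ ?_) i <;> simp
    rw [e₁]
    simp only [e₂]
    exact h x _
  constructor
  · rintro ⟨a, ha⟩
    induction a using Germ.inductionOn with
    | h a => exact ((key a).1 ha).mono fun k hk ↦ ⟨a k, hk⟩
  · intro hex
    obtain ⟨a, ha⟩ := exists_forall_eventually hex
    exact ⟨a, (key a).2 ha⟩

/-- A function on the ultrapower given by a sequence of functions. -/
def InternalFun {β : Type u} (f : (Fin n → Ultrapower K) → (Fin m → Ultrapower Γ) → Ultrapower β)
    (φ : ℕ → (Fin n → K) → (Fin m → Γ) → β) : Prop :=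
  ∀ (x : Fin n → ℕ → K) (y : Fin m → ℕ → Γ),
    f (fun i ↦ (x i : Ultrapower K)) (fun j ↦ (y j : Ultrapower Γ)) =
      ((fun k ↦ φ k (fun i ↦ x i k) (fun j ↦ y j k) : ℕ → β) : Ultrapower β)

omit [Field K] [LinearOrderedAddCommGroupWithTop Γ] in
theorem InternalFun.map {β β' : Type u}
    {f : (Fin n → Ultrapower K) → (Fin m → Ultrapower Γ) → Ultrapower β}
    {φ : ℕ → (Fin n → K) → (Fin m → Γ) → β} (hf : InternalFun f φ) (op : β → β') :
    InternalFun (fun x y ↦ (f x y).map op) fun k x y ↦ op (φ k x y) :=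
  fun x y ↦ congrArg (Germ.map op) (hf x y)

omit [Field K] [LinearOrderedAddCommGroupWithTop Γ] in
theorem InternalFun.map₂ {β β' β'' : Type u}
    {f : (Fin n → Ultrapower K) → (Fin m → Ultrapower Γ) → Ultrapower β}
    {φ : ℕ → (Fin n → K) → (Fin m → Γ) → β} (hf : InternalFun f φ)
    {g : (Fin n → Ultrapower K) → (Fin m → Ultrapower Γ) → Ultrapower β'}
    {ψ : ℕ → (Fin n → K) → (Fin m → Γ) → β'} (hg : InternalFun g ψ) (op : β → β' → β'') :
    InternalFun (fun x y ↦ Germ.map₂ op (f x y) (g x y)) fun k x y ↦ op (φ k x y) (ψ k x y) :=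
  fun x y ↦ congrArg₂ (Germ.map₂ op) (hf x y) (hg x y)

omit [Field K] [LinearOrderedAddCommGroupWithTop Γ] in
theorem InternalFun.eq {β : Type u}
    {f g : (Fin n → Ultrapower K) → (Fin m → Ultrapower Γ) → Ultrapower β}
    {φ ψ : ℕ → (Fin n → K) → (Fin m → Γ) → β} (hf : InternalFun f φ) (hg : InternalFun g ψ) :
    Internal {p | f p.1 p.2 = g p.1 p.2} fun k ↦ {p | φ k p.1 p.2 = ψ k p.1 p.2} := by
  intro x y
  rw [Set.mem_ofPred_eq, hf x y, hg x y]
  exact Germ.coe_eq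

omit [Field K] in
theorem InternalFun.le {f g : (Fin n → Ultrapower K) → (Fin m → Ultrapower Γ) → Ultrapower Γ}
    {φ ψ : ℕ → (Fin n → K) → (Fin m → Γ) → Γ} (hf : InternalFun f φ) (hg : InternalFun g ψ) :
    Internal {p | f p.1 p.2 ≤ g p.1 p.2} fun k ↦ {p | φ k p.1 p.2 ≤ ψ k p.1 p.2} := by
  intro x y
  rw [Set.mem_ofPred_eq, hf x y, hg x y]
  exact Germ.coe_le

end Internal

variable {n m : ℕ}

omit [LinearOrderedAddCommGroupWithTop Γ] in
theorem FieldTerm.exists_internalFun {A : Set (Ultrapower K)} (t : FieldTerm A n) :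
    ∃ φ : ℕ → (Fin n → K) → (Fin m → Γ) → K, InternalFun (fun x _ ↦ t.realize x) φ := by
  induction t with
  | var i => exact ⟨fun _ x _ ↦ x i, fun _ _ ↦ rfl⟩
  | param a =>
    obtain ⟨f, hf⟩ : ∃ f : ℕ → K, (f : Ultrapower K) = a :=
      Germ.inductionOn a.1 fun f ↦ ⟨f, rfl⟩
    exact ⟨fun k _ _ ↦ f k, fun _ _ ↦ hf.symm⟩
  | zero => exact ⟨fun _ _ _ ↦ 0, fun _ _ ↦ rfl⟩
  | one => exact ⟨fun _ _ _ ↦ 1, fun _ _ ↦ rfl⟩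
  | neg s ih => obtain ⟨φ, h⟩ := ih; exact ⟨_, h.map Neg.neg⟩
  | add s t ih₁ ih₂ =>
    obtain ⟨φ, h⟩ := ih₁
    obtain ⟨ψ, h'⟩ := ih₂
    exact ⟨_, h.map₂ h' (· + ·)⟩
  | mul s t ih₁ ih₂ =>
    obtain ⟨φ, h⟩ := ih₁
    obtain ⟨ψ, h'⟩ := ih₂
    exact ⟨_, h.map₂ h' (· * ·)⟩

theorem ValueTerm.exists_internalFun {A : Set (Ultrapower K)} {C : Set (Ultrapower Γ)}
    (t : ValueTerm A C n m) :
    ∃ φ : ℕ → (Fin n → K) → (Fin m → Γ) → Γ, InternalFun (t.realize (ultraVal v)) φ := by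
  induction t with
  | var i => exact ⟨fun _ _ y ↦ y i, fun _ _ ↦ rfl⟩
  | param c =>
    obtain ⟨f, hf⟩ : ∃ f : ℕ → Γ, (f : Ultrapower Γ) = c :=
      Germ.inductionOn c.1 fun f ↦ ⟨f, rfl⟩
    exact ⟨fun k _ _ ↦ f k, fun _ _ ↦ hf.symm⟩
  | val t => obtain ⟨φ, h⟩ := t.exists_internalFun (m := m) (Γ := Γ); exact ⟨_, h.map v⟩
  | infty => exact ⟨fun _ _ _ ↦ ⊤, fun _ _ ↦ rfl⟩
  | zero => exact ⟨fun _ _ _ ↦ 0, fun _ _ ↦ rfl⟩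
  | neg s ih => obtain ⟨φ, h⟩ := ih; exact ⟨_, h.map Neg.neg⟩
  | add s t ih₁ ih₂ =>
    obtain ⟨φ, h⟩ := ih₁
    obtain ⟨ψ, h'⟩ := ih₂
    exact ⟨_, h.map₂ h' (· + ·)⟩

/-- Definable sets of the ultrapower are internal. -/
theorem VFormula.exists_internal {A : Set (Ultrapower K)} {C : Set (Ultrapower Γ)}
    (φ : VFormula A C n m) : ∃ Φ, Internal {p | φ.Realize (ultraVal v) p.1 p.2} Φ := by
  induction φ with
  | @eqField n m s t =>
    obtain ⟨f, hf⟩ := s.exists_internalFun (m := m) (Γ := Γ)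
    obtain ⟨g, hg⟩ := t.exists_internalFun (m := m) (Γ := Γ)
    exact ⟨_, hf.eq hg⟩
  | eqValue s t =>
    obtain ⟨f, hf⟩ := s.exists_internalFun (v := v)
    obtain ⟨g, hg⟩ := t.exists_internalFun (v := v)
    exact ⟨_, hf.eq hg⟩
  | leValue s t =>
    obtain ⟨f, hf⟩ := s.exists_internalFun (v := v)
    obtain ⟨g, hg⟩ := t.exists_internalFun (v := v)
    exact ⟨_, hf.le hg⟩
  | not φ ih => obtain ⟨Φ, h⟩ := ih; exact ⟨_, h.compl⟩
  | and φ ψ ih₁ ih₂ =>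
    obtain ⟨Φ, h⟩ := ih₁
    obtain ⟨Ψ, h'⟩ := ih₂
    exact ⟨_, h.inter h'⟩
  | exField φ ih => obtain ⟨Φ, h⟩ := ih; exact ⟨_, h.exField⟩
  | exValue φ ih => obtain ⟨Φ, h⟩ := ih; exact ⟨_, h.exValue⟩

omit [LinearOrderedAddCommGroupWithTop Γ] in
theorem FieldTerm.exists_ultra {A : Set K} (t : FieldTerm A n) :
    ∃ s : FieldTerm (Set.univ : Set (Ultrapower K)) n,
      InternalFun (fun x (_ : Fin m → Ultrapower Γ) ↦ s.realize x) fun _ x _ ↦ t.realize x := by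
  induction t with
  | var i => exact ⟨.var i, fun _ _ ↦ rfl⟩
  | param a => exact ⟨.param ⟨((fun _ ↦ a : ℕ → K) : Ultrapower K), trivial⟩, fun _ _ ↦ rfl⟩
  | zero => exact ⟨.zero, fun _ _ ↦ rfl⟩
  | one => exact ⟨.one, fun _ _ ↦ rfl⟩
  | neg s ih => obtain ⟨s', h⟩ := ih; exact ⟨.neg s', h.map Neg.neg⟩
  | add s t ih₁ ih₂ =>
    obtain ⟨s', h⟩ := ih₁
    obtain ⟨t', h'⟩ := ih₂
    exact ⟨.add s' t', h.map₂ h' (· + ·)⟩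
  | mul s t ih₁ ih₂ =>
    obtain ⟨s', h⟩ := ih₁
    obtain ⟨t', h'⟩ := ih₂
    exact ⟨.mul s' t', h.map₂ h' (· * ·)⟩

theorem ValueTerm.exists_ultra {A : Set K} {C : Set Γ} (t : ValueTerm A C n m) :
    ∃ s : ValueTerm (Set.univ : Set (Ultrapower K)) (Set.univ : Set (Ultrapower Γ)) n m,
      InternalFun (s.realize (ultraVal v)) fun _ ↦ t.realize v := by
  induction t with
  | var i => exact ⟨.var i, fun _ _ ↦ rfl⟩
  | param c => exact ⟨.param ⟨((fun _ ↦ c : ℕ → Γ) : Ultrapower Γ), trivial⟩, fun _ _ ↦ rfl⟩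
  | val t => obtain ⟨s, h⟩ := t.exists_ultra (m := m) (Γ := Γ); exact ⟨.val s, h.map v⟩
  | infty => exact ⟨.infty, fun _ _ ↦ rfl⟩
  | zero => exact ⟨.zero, fun _ _ ↦ rfl⟩
  | neg s ih => obtain ⟨s', h⟩ := ih; exact ⟨.neg s', h.map Neg.neg⟩
  | add s t ih₁ ih₂ =>
    obtain ⟨s', h⟩ := ih₁
    obtain ⟨t', h'⟩ := ih₂
    exact ⟨.add s' t', h.map₂ h' (· + ·)⟩

/-- Łoś's theorem: every formula over `K` has a counterpart over the ultrapower. -/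
theorem VFormula.exists_ultra {A : Set K} {C : Set Γ} (φ : VFormula A C n m) :
    ∃ ψ : VFormula (Set.univ : Set (Ultrapower K)) (Set.univ : Set (Ultrapower Γ)) n m,
      Internal {p | ψ.Realize (ultraVal v) p.1 p.2} fun _ ↦ {p | φ.Realize v p.1 p.2} := by
  induction φ with
  | @eqField n m s t =>
    obtain ⟨f, hf⟩ := s.exists_ultra (m := m) (Γ := Γ)
    obtain ⟨g, hg⟩ := t.exists_ultra (m := m) (Γ := Γ)
    exact ⟨.eqField f g, hf.eq hg⟩
  | eqValue s t =>
    obtain ⟨f, hf⟩ := s.exists_ultra (v := v)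
    obtain ⟨g, hg⟩ := t.exists_ultra (v := v)
    exact ⟨.eqValue f g, hf.eq hg⟩
  | leValue s t =>
    obtain ⟨f, hf⟩ := s.exists_ultra (v := v)
    obtain ⟨g, hg⟩ := t.exists_ultra (v := v)
    exact ⟨.leValue f g, hf.le hg⟩
  | not φ ih => obtain ⟨ψ, h⟩ := ih; exact ⟨.not ψ, h.compl⟩
  | and φ φ' ih₁ ih₂ =>
    obtain ⟨ψ, h⟩ := ih₁
    obtain ⟨ψ', h'⟩ := ih₂
    exact ⟨.and ψ ψ', h.inter h'⟩
  | exField φ ih => obtain ⟨ψ, h⟩ := ih; exact ⟨.exField ψ, h.exField⟩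
  | exValue φ ih => obtain ⟨ψ, h⟩ := ih; exact ⟨.exValue ψ, h.exValue⟩

theorem Definable.exists_internal {S : Set (Ultrapower K)} (hS : Definable (ultraVal v) S) :
    ∃ Φ : ℕ → Set K, ∀ x : ℕ → K, (x : Ultrapower K) ∈ S ↔
      ∀ᶠ k in (hyperfilter ℕ : Filter ℕ), x k ∈ Φ k := by
  obtain ⟨φ, hφ⟩ := (definable_iff _ S).1 hS
  obtain ⟨Φ, hΦ⟩ := φ.exists_internal (v := v)
  refine ⟨fun k ↦ {a | ((fun _ ↦ a), Fin.elim0) ∈ Φ k}, fun x ↦ ?_⟩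
  have h1 := hΦ (fun _ ↦ x) Fin.elim0
  rw [Set.mem_ofPred_eq, hφ] at h1
  rw [h1]
  refine eventually_congr (Eventually.of_forall fun k ↦ ?_)
  rw [Set.mem_ofPred_eq, Subsingleton.elim (fun j : Fin 0 ↦ (Fin.elim0 j : ℕ → Γ) k) Fin.elim0]

variable (v) in
/-- The ultrapower is countably saturated. -/
theorem countablySaturated_ultraVal : CountablySaturated (ultraVal v) := by
  intro ι _ S hS hfin
  rcases isEmpty_or_nonempty ι with hι | hι
  · exact ⟨0, fun i ↦ hι.elim i⟩
  obtain ⟨e, he⟩ := exists_surjective_nat ι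
  choose Φ hΦ using fun i ↦ (hS i).exists_internal
  -- Diagonal argument: the `k`-th coordinate is chosen to satisfy as many initial conditions as
  -- possible, up to `k`. Each fixed condition then holds almost everywhere, since the ultrafilter
  -- is nonprincipal.
  let P : ℕ → ℕ → Prop := fun k N ↦ ∃ a, ∀ j < N, a ∈ Φ (e j) k
  have hP : ∀ N, ∀ᶠ k in (hyperfilter ℕ : Filter ℕ), P k N := by
    classical
    intro N
    obtain ⟨x, hx⟩ := hfin ((Finset.range N).image e)
    induction x using Germ.inductionOn with
    | h x =>
      have : ∀ j ∈ Finset.range N, ∀ᶠ k in (hyperfilter ℕ : Filter ℕ), x k ∈ Φ (e j) k :=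
        fun j hj ↦ (hΦ _ x).1 (hx _ (Finset.mem_image_of_mem _ hj))
      filter_upwards [(eventually_all_finset _).2 this] with k hk
      exact ⟨x k, fun j hj ↦ hk j (Finset.mem_range.2 hj)⟩
  classical
  have hG : ∀ k, P k (Nat.findGreatest (P k) k) := fun k ↦
    Nat.findGreatest_spec (zero_le (a := k)) ⟨0, fun j hj ↦ absurd hj (Nat.not_lt_zero j)⟩
  choose x hx using hG
  refine ⟨(x : Ultrapower K), fun i ↦ ?_⟩
  obtain ⟨j, rfl⟩ := he i
  refine (hΦ _ x).2 ?_
  filter_upwards [hP (j + 1), Nat.hyperfilter_le_atTop (eventually_ge_atTop (j + 1))] with k hk hjk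
  exact hx k j (Nat.lt_of_succ_le (Nat.le_findGreatest hjk hk))

theorem IsBall.exists_internal {W : AddSubgroup (Ultrapower K)} (hW : IsBall (ultraVal v) W) :
    ∃ B : ℕ → AddSubgroup K, (∀ k, IsBall v (B k)) ∧ ∀ x : ℕ → K, (x : Ultrapower K) ∈ W ↔
      ∀ᶠ k in (hyperfilter ℕ : Filter ℕ), x k ∈ B k := by
  classical
  rcases hW with ⟨r, hr⟩ | ⟨r, hr⟩ | rfl
  · induction r using Germ.inductionOn with
    | h r =>
      refine ⟨fun k ↦ closedBallSubgroup v (r k), fun k ↦ isBall_closedBallSubgroup _, fun x ↦ ?_⟩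
      rw [← SetLike.mem_coe, hr]
      exact Germ.coe_le
  · induction r using Germ.inductionOn with
    | h r =>
      have hlt : ∀ x : ℕ → K, (x : Ultrapower K) ∈ W ↔
          ∀ᶠ k in (hyperfilter ℕ : Filter ℕ), r k < v (x k) := by
        intro x
        rw [← SetLike.mem_coe, hr]
        exact Germ.coe_lt
      have hr' : ∀ᶠ k in (hyperfilter ℕ : Filter ℕ), r k ≠ ⊤ :=
        ((hlt fun _ ↦ 0).1 (zero_mem W)).mono fun k hk ↦ (hk.trans_le le_top).ne
      -- Radius `⊤` occurs only in negligibly many coordinates because `0 ∈ W`; the value there is a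
      -- dummy.
      refine ⟨fun k ↦ if h : r k ≠ ⊤ then openBallSubgroup v (r k) h else ⊤, fun k ↦ ?_,
        fun x ↦ (hlt x).trans (eventually_congr ?_)⟩
      · by_cases h : r k ≠ ⊤
        · simp only [dif_pos h]
          exact isBall_openBallSubgroup _ _
        · simp only [dif_neg h]
          exact Or.inr (Or.inr rfl)
      · filter_upwards [hr'] with k hk
        simp only [dif_pos hk]
        exact Iff.rfl
  · exact ⟨fun _ ↦ ⊤, fun _ ↦ Or.inr (Or.inr rfl),
      fun x ↦ iff_of_true trivial (Eventually.of_forall fun _ ↦ trivial)⟩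

/-- Every nonempty definable set of an algebraically closed valued field has a width. -/
theorem Definable.hasWidth [IsAlgClosed K] (hsurj : Function.Surjective v)
    (hv : ∃ x : K, x ≠ 0 ∧ v x ≠ 0) {X : Set K} (hX : Definable v X) (hne : X.Nonempty) :
    HasWidth v X := by
  classical
  obtain ⟨φ, hφ⟩ := (definable_iff v X).1 hX
  obtain ⟨ψ, hψ⟩ := φ.exists_ultra (v := v)
  let Y : Set (Ultrapower K) := {a | ψ.Realize (ultraVal v) (fun _ ↦ a) Fin.elim0}
  have hY : Definable (ultraVal v) Y := by
    refine (definable_iff _ Y).2 ⟨ψ, fun x y ↦ ?_⟩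
    rw [Set.mem_ofPred_eq, Subsingleton.elim y Fin.elim0]
    refine iff_of_eq (congrArg (fun z ↦ ψ.Realize (ultraVal v) z Fin.elim0) (funext fun i ↦ ?_))
    rw [Subsingleton.elim i 0]
  have hYX : ∀ x : ℕ → K, (x : Ultrapower K) ∈ Y ↔
      ∀ᶠ k in (hyperfilter ℕ : Filter ℕ), x k ∈ X := by
    intro x
    have h1 := hψ (fun _ ↦ x) Fin.elim0
    rw [Set.mem_ofPred_eq] at h1
    refine Iff.trans (iff_of_eq ?_) (h1.trans (eventually_congr (Eventually.of_forall fun k ↦ ?_)))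
    · exact congrArg (ψ.Realize (ultraVal v) _) (Subsingleton.elim _ _)
    · exact hφ _ _
  obtain ⟨a, ha⟩ := hne
  obtain ⟨W, hW, ⟨T, hT⟩, hWY⟩ := hY.hasWidth_of_countablySaturated (ultraVal_surjective hsurj)
    (ultraVal_nontrivial hv) (countablySaturated_ultraVal v)
    ⟨((fun _ ↦ a : ℕ → K) : Ultrapower K), (hYX _).2 (Eventually.of_forall fun _ ↦ ha)⟩
  obtain ⟨B, hB, hWB⟩ := hW.exists_internal
  obtain ⟨τ, hτ⟩ := exists_rep (fun t : T ↦ (t : Ultrapower K))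
  -- A failure in almost all coordinates would give a germ in `Y` outside every coset. The finite
  -- index set `T` is the same for all `k`.
  have h1 : ∀ᶠ k in (hyperfilter ℕ : Filter ℕ), ∀ x ∈ X, ∃ t : T, x - τ t k ∈ B k := by
    by_contra hcon
    rw [← Ultrafilter.eventually_not] at hcon
    obtain ⟨x, hx⟩ := exists_forall_eventually
      (p := fun k x ↦ x ∈ X ∧ ∀ t : T, x - τ t k ∉ B k)
      (hcon.mono fun k hk ↦ by push Not at hk; exact hk)
    obtain ⟨t, ht, hxt⟩ := hT (x : Ultrapower K) ((hYX x).2 (hx.mono fun k hk ↦ hk.1))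
    have ht' : t = (τ ⟨t, ht⟩ : Ultrapower K) := congrFun hτ ⟨t, ht⟩
    rw [ht'] at hxt
    obtain ⟨k, hk, hk'⟩ := (((hWB (x - τ ⟨t, ht⟩)).1 hxt).and hx).exists
    exact hk'.2 _ hk
  have h2 : ∀ᶠ k in (hyperfilter ℕ : Filter ℕ), ∀ w ∈ B k, ∃ x ∈ X, x + w ∈ X := by
    by_contra hcon
    rw [← Ultrafilter.eventually_not] at hcon
    obtain ⟨w, hw⟩ := exists_forall_eventually
      (p := fun k w ↦ w ∈ B k ∧ ∀ x ∈ X, x + w ∉ X)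
      (hcon.mono fun k hk ↦ by push Not at hk; exact hk)
    obtain ⟨x, hx, hxw⟩ := hWY (w : Ultrapower K) ((hWB w).2 (hw.mono fun k hk ↦ hk.1))
    induction x using Germ.inductionOn with
    | h x =>
      obtain ⟨k, ⟨hk, hk'⟩, hk''⟩ := (((hYX x).1 hx).and ((hYX (x + w)).1 hxw)).and hw |>.exists
      exact hk''.2 _ hk hk'
  -- One good coordinate already provides a ball and finitely many centres in `K`.
  obtain ⟨k, hk1, hk2⟩ := (h1.and h2).exists
  refine ⟨B k, hB k, ⟨Finset.univ.image fun t ↦ τ t k, fun x hx ↦ ?_⟩, hk2⟩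
  obtain ⟨t, ht⟩ := hk1 x hx
  exact ⟨_, Finset.mem_image_of_mem _ (Finset.mem_univ t), ht⟩

end Ultrapower

/-! ### Definable and type-definable subgroups. -/

section Subgroups

variable {K Γ : Type u} [Field K] [LinearOrderedAddCommGroupWithTop Γ] {v : AddValuation K Γ}

/-- Elements of `H` close to the same `t ∈ T` differ by an element of `W`, so the cosets of `W` in
`H` inject into `T`. -/
theorem isFiniteRelIndex_of_cover {W H : AddSubgroup K} (T : Finset K)
    (hT : ∀ x ∈ H, ∃ t ∈ T, x - t ∈ W) : W.IsFiniteRelIndex H := by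
  have hT' : ∀ x : H, ∃ t : T, (x : K) - t ∈ W := fun x ↦
    let ⟨t, ht, hxt⟩ := hT x x.2
    ⟨⟨t, ht⟩, hxt⟩
  choose τ hτ using hT'
  have hinj : Function.Injective fun q : H ⧸ W.addSubgroupOf H ↦ τ q.out := by
    intro q q' h
    rw [← q.out_eq', ← q'.out_eq']
    refine QuotientAddGroup.eq.2 ?_
    rw [AddSubgroup.mem_addSubgroupOf]
    have h1 := sub_mem (hτ q'.out) (hτ q.out)
    have h' : τ q.out = τ q'.out := h
    rw [h', sub_sub_sub_cancel_right] at h1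
    rw [AddSubgroup.coe_add, AddSubgroup.coe_neg, neg_add_eq_sub]
    exact h1
  have := Finite.of_injective _ hinj
  have : (W.addSubgroupOf H).FiniteIndex := AddSubgroup.finiteIndex_of_finite_quotient
  exact ⟨AddSubgroup.FiniteIndex.index_ne_zero⟩

/-- A definable subgroup is the whole field, finite, or a finite extension of a ball. -/
theorem Definable.addSubgroup_trichotomy [IsAlgClosed K] (hsurj : Function.Surjective v)
    (hv : ∃ x : K, x ≠ 0 ∧ v x ≠ 0) (H : AddSubgroup K) (hH : Definable v (H : Set K)) :
    H = ⊤ ∨ Finite H ∨ ∃ (r : Γ) (B : AddSubgroup K), r ≠ ⊤ ∧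
      ((B : Set K) = closedBall v r ∨ (B : Set K) = openBall v r) ∧
      B ≤ H ∧ B.IsFiniteRelIndex H := by
  obtain ⟨W, hW, ⟨T, hT⟩, hWH⟩ := hH.hasWidth hsurj hv ⟨0, H.zero_mem⟩
  have hle : W ≤ H := fun w hw ↦ by
    obtain ⟨x, hx, hxw⟩ := hWH w hw
    simpa using sub_mem (show x + w ∈ H from hxw) hx
  rcases hW with ⟨r, hr⟩ | ⟨r, hr⟩ | rfl
  -- The closed ball of radius `⊤` is `{0}`, so its finitely many cosets make `H` finite.
  · by_cases hrt : r = ⊤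
    · right; left
      refine Set.Finite.subset T.finite_toSet fun x hx ↦ ?_
      obtain ⟨t, ht, hxt⟩ := hT x hx
      rw [← SetLike.mem_coe, hr, hrt] at hxt
      have h0 : x - t = 0 := v.top_iff.1 (top_le_iff.1 hxt)
      rw [sub_eq_zero.1 h0]
      exact ht
    · exact Or.inr (Or.inr ⟨r, W, hrt, Or.inl hr, hle, isFiniteRelIndex_of_cover T hT⟩)
  · refine Or.inr (Or.inr ⟨r, W, ?_, Or.inr hr, hle, isFiniteRelIndex_of_cover T hT⟩)
    have h0 : (0 : K) ∈ openBall v r := by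
      rw [← hr]
      exact W.zero_mem
    exact (lt_of_lt_of_le (show r < v 0 from h0) le_top).ne
  · exact Or.inl (top_le_iff.1 hle)

theorem Definable.exists_finite_params {X : Set K} (hX : Definable v X) :
    ∃ (A₀ : Set K) (C₀ : Set Γ), A₀.Finite ∧ C₀.Finite ∧ ∀ A C, A₀ ⊆ A → C₀ ⊆ C →
      ∃ ψ : VFormula A C 1 0, ∀ x y, ψ.Realize v x y ↔ x 0 ∈ X := by
  obtain ⟨φ, hφ⟩ := (definable_iff v X).1 hX
  obtain ⟨A₀, C₀, hA₀, hC₀, h⟩ := φ.exists_finite_params v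
  refine ⟨A₀, C₀, hA₀, hC₀, fun A C hA hC ↦ ?_⟩
  obtain ⟨ψ, hψ⟩ := h A C hA hC
  exact ⟨ψ, fun x y ↦ (hψ x y).trans (hφ x y)⟩

theorem mk_biUnion_lt {α β : Type u} {κ : Cardinal.{u}} (hκ : Cardinal.aleph0 < κ)
    {𝒟 : Set α} (h𝒟 : Cardinal.mk 𝒟 < κ) {f : 𝒟 → Set β} (hf : ∀ D, (f D).Finite) :
    Cardinal.mk (⋃ D, f D : Set β) < κ := by
  refine (Cardinal.mk_iUnion_le f).trans_lt
    (Cardinal.mul_lt_of_lt hκ.le h𝒟 (lt_of_le_of_lt ?_ hκ))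
  exact ciSup_le' fun D ↦ (hf D).countable.le_aleph0

/-- Compactness: the group law of a type-definable subgroup is controlled by a definable
neighbourhood. -/
theorem exists_definable_superset {κ : Cardinal.{u}} (hκ : Cardinal.aleph0 < κ)
    (hsat : IsSaturated v κ) (X : AddSubgroup K) {𝒟 : Set (Set K)} (h𝒟 : Cardinal.mk 𝒟 < κ)
    (hdef : ∀ D ∈ 𝒟, Definable v D) (hX : (X : Set K) = ⋂₀ 𝒟) {D : Set K} (hD : D ∈ 𝒟) :
    ∃ E, Definable v E ∧ (X : Set K) ⊆ E ∧ ∀ x ∈ E, ∀ y ∈ E, ∀ z ∈ E, x + y - z ∈ D := by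
  by_contra hcon
  push Not at hcon
  choose A₀ C₀ hA₀ hC₀ hψ using fun D : 𝒟 ↦ (hdef D D.2).exists_finite_params
  have hψ' := fun D : 𝒟 ↦ hψ D (⋃ D, A₀ D) (⋃ D, C₀ D) (Set.subset_iUnion A₀ D)
    (Set.subset_iUnion C₀ D)
  choose ψ hψ' using hψ'
  -- A point of all `U S` consists of three elements of `X` and, as coordinate `3`, their
  -- combination `x + y - z` outside `D`, which is impossible. The equation avoids subtraction,
  -- which the language lacks.
  let U : Set K → Set ((Fin 4 → K) × (Fin 0 → Γ)) := fun S ↦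
    {p | (p.1 0 ∈ S ∧ p.1 1 ∈ S ∧ p.1 2 ∈ S) ∧ p.1 3 + p.1 2 = p.1 0 + p.1 1 ∧ p.1 3 ∉ D}
  obtain ⟨p, hp⟩ := hsat (⋃ D, A₀ D) (⋃ D, C₀ D) (mk_biUnion_lt hκ h𝒟 hA₀)
    (mk_biUnion_lt hκ h𝒟 hC₀) 4 0 (U '' 𝒟) (by
      rintro _ ⟨S, hS, rfl⟩
      refine ⟨.and (.and ((ψ ⟨S, hS⟩).rename fun _ ↦ 0) (.and ((ψ ⟨S, hS⟩).rename fun _ ↦ 1)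
        ((ψ ⟨S, hS⟩).rename fun _ ↦ 2))) (.and (.eqField (.add (.var 3) (.var 2))
          (.add (.var 0) (.var 1))) (.not ((ψ ⟨D, hD⟩).rename fun _ ↦ 3))), ?_⟩
      ext p
      simp only [VFormula.Realize, VFormula.realize_rename, hψ', FieldTerm.realize]
      exact Iff.rfl) (by
      intro 𝒯 h𝒯 hfin
      obtain ⟨𝒞, h𝒞, hCfin, rfl⟩ : ∃ 𝒞 ⊆ 𝒟, 𝒞.Finite ∧ 𝒯 = U '' 𝒞 :=
        Set.exists_subset_image_finite_and.1 ⟨𝒯, h𝒯, hfin, rfl⟩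
      -- For finitely many members of `𝒟`, their intersection is a definable superset of `X`, to
      -- which the assumed failure applies.
      obtain ⟨x, hx, y, hy, z, hz, hxyz⟩ := hcon (⋂ S ∈ hCfin.toFinset, S)
        (definable_biInter _ fun S hS ↦ hdef S (h𝒞 (hCfin.mem_toFinset.1 hS)))
        (by
          rw [hX]
          exact Set.subset_iInter₂ fun S hS ↦
            Set.sInter_subset_of_mem (h𝒞 (hCfin.mem_toFinset.1 hS)))
      refine ⟨(![x, y, z, x + y - z], Fin.elim0), ?_⟩
      rintro _ ⟨S, hS, rfl⟩
      have hS' := hCfin.mem_toFinset.2 hS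
      exact ⟨⟨Set.mem_iInter₂.1 hx S hS', Set.mem_iInter₂.1 hy S hS', Set.mem_iInter₂.1 hz S hS'⟩,
        sub_add_cancel _ _, hxyz⟩)
  have hpU : ∀ S ∈ 𝒟, p ∈ U S := fun S hS ↦ hp _ (Set.mem_image_of_mem U hS)
  have hpX : ∀ i : Fin 4, (∀ S ∈ 𝒟, p.1 i ∈ S) → p.1 i ∈ X := fun i hi ↦ by
    rw [← SetLike.mem_coe, hX]
    exact hi
  have h0 := hpX 0 fun S hS ↦ (hpU S hS).1.1
  have h1 := hpX 1 fun S hS ↦ (hpU S hS).1.2.1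
  have h2 := hpX 2 fun S hS ↦ (hpU S hS).1.2.2
  obtain ⟨-, heq, hnot⟩ := hpU D hD
  refine hnot ?_
  have h3 : p.1 3 ∈ X := by
    rw [eq_sub_of_add_eq heq]
    exact sub_mem (add_mem h0 h1) h2
  rw [← SetLike.mem_coe, hX] at h3
  exact h3 D hD

/-- `X + W` is the union of the finitely many cosets of `W` centred in `T` that meet `X`, each of
them definable. -/
theorem IsBall.definable_sup {W : AddSubgroup K} (hW : IsBall v W) (X : AddSubgroup K)
    (T : Finset K) (hT : ∀ x ∈ X, ∃ t ∈ T, x - t ∈ W) :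
    Definable v ((X ⊔ W : AddSubgroup K) : Set K) := by
  classical
  have : ((X ⊔ W : AddSubgroup K) : Set K) =
      ⋃ t ∈ T.filter fun t ↦ ∃ x ∈ X, x - t ∈ W, {x | x - t ∈ W} := by
    ext g
    simp only [SetLike.mem_coe, AddSubgroup.mem_sup, Set.mem_iUnion, Finset.mem_filter,
      Set.mem_ofPred_eq, exists_prop]
    constructor
    · rintro ⟨x, hx, w, hw, rfl⟩
      obtain ⟨t, ht, hxt⟩ := hT x hx
      refine ⟨t, ⟨ht, x, hx, hxt⟩, ?_⟩
      rw [add_sub_right_comm]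
      exact add_mem hxt hw
    · rintro ⟨t, ⟨-, x, hx, hxt⟩, hgt⟩
      refine ⟨x, hx, g - x, ?_, by ring⟩
      simpa using sub_mem hgt hxt
  rw [this]
  exact definable_biUnion _ fun t _ ↦ hW.definable_coset t

/-- A type-definable subgroup is an intersection of definable subgroups. -/
theorem TypeDefinable.exists_eq_sInf [IsAlgClosed K] (hsurj : Function.Surjective v)
    (hv : ∃ x : K, x ≠ 0 ∧ v x ≠ 0) {κ : Cardinal.{u}} (hκ : Cardinal.aleph0 < κ)
    (hsat : IsSaturated v κ) (X : AddSubgroup K) (hX : TypeDefinable v κ (X : Set K)) :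
    ∃ 𝒢 : Set (AddSubgroup K), Cardinal.mk 𝒢 < κ ∧
      (∀ G ∈ 𝒢, Definable v (G : Set K)) ∧ X = sInf 𝒢 := by
  obtain ⟨𝒟, h𝒟, hdef, hXD⟩ := hX
  have key : ∀ D : 𝒟, ∃ G : AddSubgroup K, Definable v (G : Set K) ∧ X ≤ G ∧ (G : Set K) ⊆ D := by
    intro D
    obtain ⟨E, hE, hXE, hED⟩ := exists_definable_superset hκ hsat X h𝒟 hdef hXD D.2
    obtain ⟨W, hW, ⟨T, hT⟩, hWE⟩ := hE.hasWidth hsurj hv ⟨0, hXE X.zero_mem⟩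
    -- The ball `W` need not lie in `E`, but each `w ∈ W` is a difference of elements of `E`, so `X
    -- + W ⊆ E + E - E ⊆ D`.
    refine ⟨X ⊔ W, hW.definable_sup X T fun x hx ↦ hT x (hXE hx), le_sup_left, ?_⟩
    rintro g hg
    obtain ⟨x, hx, w, hw, rfl⟩ := AddSubgroup.mem_sup.1 hg
    obtain ⟨y, hy, hyw⟩ := hWE w hw
    have := hED x (hXE hx) (y + w) hyw y hy
    rwa [show x + (y + w) - y = x + w by ring] at this
  choose G hG hXG hGD using key
  refine ⟨Set.range G, Cardinal.mk_range_le.trans_lt h𝒟, ?_, le_antisymm ?_ ?_⟩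
  · rintro _ ⟨D, rfl⟩
    exact hG D
  · refine le_sInf ?_
    rintro _ ⟨D, rfl⟩
    exact hXG D
  · intro x hx
    rw [← SetLike.mem_coe, hXD]
    exact fun D hD ↦ hGD ⟨D, hD⟩ (AddSubgroup.mem_sInf.1 hx _ ⟨⟨D, hD⟩, rfl⟩)

end Subgroups

end ACVF

theorem mainTheorem5 {K Γ : Type u} [Field K] [IsAlgClosed K]
    [LinearOrderedAddCommGroupWithTop Γ] (v : AddValuation K Γ)
    (hsurj : Function.Surjective v) (hnontriv : ∃ x : K, x ≠ 0 ∧ v x ≠ 0) :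
    (∀ κ : Cardinal.{u}, Cardinal.aleph0 < κ → ACVF.IsSaturated v κ →
      ∀ X : AddSubgroup K, ACVF.TypeDefinable v κ (X : Set K) →
        ∃ 𝒢 : Set (AddSubgroup K), Cardinal.mk 𝒢 < κ ∧
          (∀ G ∈ 𝒢, ACVF.Definable v (G : Set K)) ∧ X = sInf 𝒢) ∧
    (∀ H : AddSubgroup K, ACVF.Definable v (H : Set K) →
      H = ⊤ ∨ Finite H ∨
        ∃ (r : Γ) (B : AddSubgroup K), r ≠ ⊤ ∧
          ((B : Set K) = ACVF.closedBall v r ∨ (B : Set K) = ACVF.openBall v r) ∧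
          B ≤ H ∧ B.IsFiniteRelIndex H) :=
  ⟨fun _ hκ hsat X hX ↦ hX.exists_eq_sInf hsurj hnontriv hκ hsat X,
    fun H hH ↦ hH.addSubgroup_trichotomy hsurj hnontriv H⟩
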